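/- Let $n\ge 1$ and $1<p\le q<\infty$. A weight is a locally integrable function $w$ on $\mathbb{R}^n$ with $w>0$ almost everywhere; cubes are bounded, non-degenerate, and have sides parallel to the coordinate axes; $|Q|$ is the Lebesgue measure of $Q$. For measurable $f$ on $\mathbb{R}^n$ let $f^{*}$ be its decreasing rearrangement, $f^{**}(t)=\frac1t\int_0^t f^{*}(s)\,ds$, and $$\|f\|_{L(p,q)}=\Big(\int_0^\infty f^{**}(t)^q\,t^{q/p}\,\frac{dt}{t}\Big)^{1/q}.$$ Let $RH_p$ be the class of weights $w$ for which there is $C>0$ with $$\Big(\frac1{|Q|}\int_Q w^p\,dx\Big)^{1/p}\le \frac{C}{|Q|}\int_Q w\,dx\quad\text{for all cubes }Q,$$ and let $RH_{L(p,q)}$ be the class of weights $w$ for which there is $C>0$ with $$\frac{\|w\chi_Q\|_{L(p,q)}}{|Q|^{1/p}}\le \frac{C}{|Q|}\int_Q w\,dx\quad\text{for all cubes }Q.$$ For $t>0$ let $K(t,f;L^1(Q),L^\infty(Q))=\inf\{\|f_0\|_{L^1(Q)}+t\|f_1\|_{L^\infty(Q)}: f=f_0+f_1,\ f_0\in L^1(Q),\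 f_1\in L^\infty(Q)\}$, and let $1/p'=1-1/p$. Theorem. $RH_{L(p,q)}=RH_p$. Moreover, a weight $w$ belongs to $RH_{L(p,q)}$ if and only if there is a constant $C>0$ such that, for all cubes $Q$ and all $0<t<|Q|$, $$\int_0^t\big[K(s,w\chi_Q;L^1(Q),L^\infty(Q))\,s^{-1/p'}\big]^q\,\frac{ds}{s}\le C\,\big[t^{-1/p'}K(t,w\chi_Q;L^1(Q),L^\infty(Q))\big]^q .$$ -/

import Mathlib

open MeasureTheory Set
open scoped ENNReal

noncomputable section

namespace ReverseHolder

/-- Closed cubes of `ℝⁿ` with sides parallel to the coordinate axes and positive side length. -/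
def IsCube {n : ℕ} (Q : Set (Fin n → ℝ)) : Prop :=
  ∃ (a : Fin n → ℝ) (h : ℝ), 0 < h ∧ Q = Icc a (fun i => a i + h)

/-- A weight on `ℝⁿ`: a locally integrable function that is positive almost everywhere. -/
def IsWeight {n : ℕ} (w : (Fin n → ℝ) → ℝ) : Prop :=
  LocallyIntegrable w volume ∧ ∀ᵐ x ∂(volume : Measure (Fin n → ℝ)), 0 < w x

/-- The average `|Q|⁻¹ ∫_Q |f|`. -/
def avg {n : ℕ} (Q : Set (Fin n → ℝ)) (f : (Fin n → ℝ) → ℝ) : ℝ≥0∞ :=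
  (∫⁻ x in Q, ‖f x‖ₑ) / volume Q

/-- The class `RH_p`: weights `w` for which there is `C > 0` such that, for all cubes `Q`,
`(|Q|⁻¹ ∫_Q w^p)^(1/p) ≤ C |Q|⁻¹ ∫_Q w`. -/
def RH (n : ℕ) (p : ℝ) : Set ((Fin n → ℝ) → ℝ) :=
  {w | IsWeight w ∧ ∃ C : ℝ, 0 < C ∧ ∀ Q : Set (Fin n → ℝ), IsCube Q →
    ((∫⁻ x in Q, ‖w x‖ₑ ^ p) / volume Q) ^ (1 / p) ≤ ENNReal.ofReal C * avg Q w}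

/-- The decreasing rearrangement `f*(t) = inf {s ≥ 0 : |{|f| > s}| ≤ t}`. -/
def rearrangement {n : ℕ} (f : (Fin n → ℝ) → ℝ) (t : ℝ) : ℝ≥0∞ :=
  sInf {s : ℝ≥0∞ | volume {x | s < ‖f x‖ₑ} ≤ ENNReal.ofReal t}

/-- The maximal rearrangement `f**(t) = t⁻¹ ∫₀ᵗ f*(s) ds`. -/
def maxRearrangement {n : ℕ} (f : (Fin n → ℝ) → ℝ) (t : ℝ) : ℝ≥0∞ :=
  (∫⁻ s in Ioo 0 t, rearrangement f s) / ENNReal.ofReal t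

/-- The Lorentz norm `‖f‖_{L(p,q)} = (∫₀^∞ f**(t)^q t^(q/p) dt/t)^(1/q)`. -/
def lorentzNorm {n : ℕ} (p q : ℝ) (f : (Fin n → ℝ) → ℝ) : ℝ≥0∞ :=
  (∫⁻ t in Ioi (0 : ℝ),
    maxRearrangement f t ^ q * ENNReal.ofReal t ^ (q / p) / ENNReal.ofReal t) ^ (1 / q)

/-- The class `RH_{L(p,q)}`: weights `w` for which there is `C > 0` such that, for all cubes `Q`,
`‖w χ_Q‖_{L(p,q)} / |Q|^(1/p) ≤ C |Q|⁻¹ ∫_Q w`. -/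
def RHLorentz (n : ℕ) (p q : ℝ) : Set ((Fin n → ℝ) → ℝ) :=
  {w | IsWeight w ∧ ∃ C : ℝ, 0 < C ∧ ∀ Q : Set (Fin n → ℝ), IsCube Q →
    lorentzNorm p q (Q.indicator w) / volume Q ^ (1 / p) ≤ ENNReal.ofReal C * avg Q w}

/-- The K-functional `K(t, f; L¹(Q), L^∞(Q))`: the infimum of `‖f₀‖_{L¹(Q)} + t ‖f₁‖_{L^∞(Q)}` over
all decompositions `f = f₀ + f₁` (a.e. on `Q`) with `f₀ ∈ L¹(Q)` and `f₁ ∈ L^∞(Q)`. -/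
def kFunctional {n : ℕ} (Q : Set (Fin n → ℝ)) (t : ℝ) (f : (Fin n → ℝ) → ℝ) : ℝ≥0∞ :=
  ⨅ (f₀ : (Fin n → ℝ) → ℝ) (f₁ : (Fin n → ℝ) → ℝ)
    (_ : MemLp f₀ 1 (volume.restrict Q)) (_ : MemLp f₁ ∞ (volume.restrict Q))
    (_ : ∀ᵐ x ∂(volume.restrict Q), f x = f₀ x + f₁ x),
    eLpNorm f₀ 1 (volume.restrict Q) + ENNReal.ofReal t * eLpNorm f₁ ∞ (volume.restrict Q)

/-- The function `s ↦ s^(-1/p') K(s, w χ_Q; L¹(Q), L^∞(Q))`, where `p' = p / (p - 1)`. -/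
def phi {n : ℕ} (p : ℝ) (w : (Fin n → ℝ) → ℝ) (Q : Set (Fin n → ℝ)) (s : ℝ) : ℝ≥0∞ :=
  kFunctional Q s (Q.indicator w) * ENNReal.ofReal s ^ (-(1 / p.conjExponent))

end ReverseHolder

end

namespace ReverseHolder

open Filter Topology Metric

variable {n : ℕ}

/-! For a cube `Q` of measure V, put f = w χ_Q, F(t) = ∫₀ᵗ f* and φ(t) = t^(1/p) f**(t). Since
|Q|^(1/p) times the average of w over `Q` is φ(V), each class says that an integral is at most C
φ(V)^r, uniformly in `Q`: RH_p bounds ∫ (s^(1/p) f*(s))^p ds/s, and the Lorentz class bounds ∫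
φ(s)^q ds/s. As F(t) ≤ K(t) ≤ 2 F(t) (`primitive_le_kFunctional`, `kFunctional_le_primitive`), the
K-functional condition says that ∫₀ᵗ φ^q ds/s ≤ C φ(t)^q for every t < V.

Because f* ≤ f**, both classes satisfy the hypothesis of the self-improvement theorem
`exists_lintegral_scaledPrimitive_le`, with r = p or r = q. That theorem returns the bound at every
scale t ≤ V and for every exponent, so all the conditions coincide.

Self-improvement rests on a localisation, `rearr_le_scaledPrimitive_of_forall_cube`: a weak-type
bound s^(1/p) f*(s) ≤ B φ(V), valid on all cubes, passes to every t ≤ V in place of V. Its engine is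
the covering argument `volume_level_le_of_forall_ball`, at the level f**(t). Localisation makes φ
quasi-increasing, so φ(t) is comparable to s^(1/p) f*(s) with s = κt (`scaledPrimitive_le_rearr`).
The integral hypothesis then forces φ(s)^r log(V/s) ≤ C φ(V)^r (`rpow_mul_log_le`), so φ is small
relative to φ(V) near 0. Localising this smallness gives φ(δt) ≤ φ(t)/2 at all scales, and iteration
turns it into power decay, which integrates to any exponent. -/

/-! ### Distribution function and decreasing rearrangement -/

/-- The distribution function `s ↦ |{|f| > s}|`. -/
noncomputable def distribution (f : (Fin n → ℝ) → ℝ) (s : ℝ≥0∞) : ℝ≥0∞ := volume {x | s < ‖f x‖ₑ}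

lemma distribution_antitone (f : (Fin n → ℝ) → ℝ) : Antitone (distribution f) :=
  fun _ _ h => measure_mono fun _ hx => lt_of_le_of_lt h hx

/-- The infimum defining f* is attained: the distribution function is right-continuous, because {|f|
> s} is the increasing union of {|f| > u_k} for u_k decreasing to s. -/
lemma rearrangement_le_iff (f : (Fin n → ℝ) → ℝ) (t : ℝ) (s : ℝ≥0∞) :
    rearrangement f t ≤ s ↔ distribution f s ≤ ENNReal.ofReal t := by
  refine ⟨fun h => ?_, fun h => sInf_le h⟩
  rcases eq_or_ne s ⊤ with rfl | hs
  · simp [distribution]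
  obtain ⟨u, hu, hus, hlim⟩ := exists_seq_strictAnti_tendsto' (lt_top_iff_ne_top.2 hs)
  have hunion : {x | s < ‖f x‖ₑ} = ⋃ k, {x | u k < ‖f x‖ₑ} := by
    ext x
    simp only [mem_ofPred_eq, mem_iUnion]
    refine ⟨fun hx => ((hlim.eventually (gt_mem_nhds hx)).exists), ?_⟩
    rintro ⟨k, hk⟩
    exact (hus k).1.trans hk
  have hmono : Monotone fun k => {x | u k < ‖f x‖ₑ} :=
    fun i j hij x (hx : u i < _) => lt_of_le_of_lt (hu.antitone hij) hx
  rw [distribution, hunion, hmono.measure_iUnion]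
  refine iSup_le fun k => ?_
  obtain ⟨v, hv, hvk⟩ := sInf_lt_iff.1 (lt_of_le_of_lt h (hus k).1)
  exact (distribution_antitone f hvk.le).trans hv

lemma lt_rearrangement_iff (f : (Fin n → ℝ) → ℝ) (t : ℝ) (s : ℝ≥0∞) :
    s < rearrangement f t ↔ ENNReal.ofReal t < distribution f s := by
  rw [← not_le, rearrangement_le_iff, not_le]

lemma rearrangement_antitone (f : (Fin n → ℝ) → ℝ) : Antitone (rearrangement f) := fun s t hst =>
  (rearrangement_le_iff f t _).2
    (((rearrangement_le_iff f s _).1 le_rfl).trans (ENNReal.ofReal_le_ofReal hst))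

lemma mul_distribution_le {f : (Fin n → ℝ) → ℝ} (hf : Integrable f) (s : ℝ≥0∞) :
    s * distribution f s ≤ ∫⁻ x, ‖f x‖ₑ :=
  le_trans (mul_le_mul_right (measure_mono fun _ (hx : s < _) => hx.le) s)
    (mul_meas_ge_le_lintegral₀ hf.aestronglyMeasurable.enorm s)

lemma distribution_ne_top {f : (Fin n → ℝ) → ℝ} (hf : Integrable f) {s : ℝ≥0∞} (hs : s ≠ 0) :
    distribution f s ≠ ⊤ := by
  intro h
  have := mul_distribution_le hf s
  rw [h, ENNReal.mul_top hs, top_le_iff] at this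
  exact hf.hasFiniteIntegral.ne this

lemma rearrangement_ne_top {f : (Fin n → ℝ) → ℝ} (hf : Integrable f) {t : ℝ} (ht : 0 < t) :
    rearrangement f t ≠ ⊤ := by
  -- Chebyshev's inequality at height I/t; the extra 1 makes the comparison strict, which also
  -- covers I = 0.
  have hle : rearrangement f t ≤ (∫⁻ x, ‖f x‖ₑ) / ENNReal.ofReal t + 1 := by
    rw [rearrangement_le_iff]
    have h1 := mul_distribution_le hf ((∫⁻ x, ‖f x‖ₑ) / ENNReal.ofReal t + 1)
    have hfin := hf.hasFiniteIntegral.ne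
    have ht0 : ENNReal.ofReal t ≠ 0 := by simpa using ht
    set I := ∫⁻ x, ‖f x‖ₑ
    by_contra! hlt
    have h2 : I < (I / ENNReal.ofReal t + 1) * ENNReal.ofReal t := by
      rw [add_mul, ENNReal.div_mul_cancel ht0 ENNReal.ofReal_ne_top, one_mul]
      exact ENNReal.lt_add_right hfin ht0
    exact absurd (h2.trans_le ((mul_le_mul_right hlt.le _).trans h1)) (lt_irrefl _)
  refine ne_top_of_le_ne_top ?_ hle
  exact ENNReal.add_ne_top.2 ⟨ENNReal.div_ne_top hf.hasFiniteIntegral.ne (by simpa using ht),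
    ENNReal.one_ne_top⟩

lemma volume_setOf_ofReal_lt {d : ℝ≥0∞} (hd : d ≠ ⊤) :
    volume {s : ℝ | 0 < s ∧ ENNReal.ofReal s < d} = d := by
  have : {s : ℝ | 0 < s ∧ ENNReal.ofReal s < d} = Ioo 0 d.toReal := by
    ext s
    simp only [mem_ofPred_eq, mem_Ioo, and_congr_right_iff]
    intro hs
    rw [ENNReal.ofReal_lt_iff_lt_toReal hs.le hd]
  rw [this, Real.volume_Ioo, sub_zero, ENNReal.ofReal_toReal hd]

/-- A function and its decreasing rearrangement have the same `L^r` norm. -/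
lemma lintegral_rearrangement_rpow {f : (Fin n → ℝ) → ℝ} (hf : Integrable f) {r : ℝ}
    (hr : 0 < r) :
    ∫⁻ s in Ioi (0 : ℝ), rearrangement f s ^ r = ∫⁻ x, ‖f x‖ₑ ^ r := by
  -- Layer cake on both sides. The integrands agree since {s > 0 : f*(s) > t} is an interval
  -- starting at 0 whose length is the measure of {|f| > t}.
  have h1 := lintegral_rpow_eq_lintegral_meas_lt_mul (volume : Measure (Fin n → ℝ))
    (f := fun x => ‖f x‖) (Eventually.of_forall fun x => norm_nonneg _)
    hf.aestronglyMeasurable.norm.aemeasurable hr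
  have h2 := lintegral_rpow_eq_lintegral_meas_lt_mul (volume.restrict (Ioi (0 : ℝ)))
    (f := fun s => (rearrangement f s).toReal) (Eventually.of_forall fun x => by positivity)
    ((rearrangement_antitone f).measurable.ennreal_toReal.aemeasurable) hr
  have e1 : ∫⁻ x, ‖f x‖ₑ ^ r = ∫⁻ x, ENNReal.ofReal (‖f x‖ ^ r) := by
    refine lintegral_congr fun x => ?_
    rw [← ofReal_norm, ENNReal.ofReal_rpow_of_nonneg (norm_nonneg _) hr.le]
  have e2 : ∫⁻ s in Ioi (0 : ℝ), rearrangement f s ^ r =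
      ∫⁻ s in Ioi (0 : ℝ), ENNReal.ofReal ((rearrangement f s).toReal ^ r) := by
    refine setLIntegral_congr_fun measurableSet_Ioi fun s hs => ?_
    rw [← ENNReal.ofReal_rpow_of_nonneg ENNReal.toReal_nonneg hr.le,
      ENNReal.ofReal_toReal (rearrangement_ne_top hf hs)]
  rw [e1, e2, h1, h2]
  congr 1
  refine setLIntegral_congr_fun measurableSet_Ioi fun t ht => ?_
  congr 1
  have ht' : (0 : ℝ) < t := ht
  have hd : distribution f (ENNReal.ofReal t) ≠ ⊤ := distribution_ne_top hf (by simpa using ht')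
  have e3 : volume {x | t < ‖f x‖} = distribution f (ENNReal.ofReal t) := by
    rw [distribution]
    congr 1
    ext x
    simp only [mem_ofPred_eq]
    rw [← ofReal_norm, ENNReal.ofReal_lt_ofReal_iff_of_nonneg ht'.le]
  rw [e3, Measure.restrict_apply (measurableSet_lt measurable_const
    (rearrangement_antitone f).measurable.ennreal_toReal), ← volume_setOf_ofReal_lt hd]
  congr 1
  ext s
  simp only [mem_inter_iff, mem_ofPred_eq, mem_Ioi]
  rw [and_comm]
  refine and_congr_right fun hs => ?_
  rw [← ENNReal.ofReal_lt_iff_lt_toReal ht'.le (rearrangement_ne_top hf hs), lt_rearrangement_iff]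

lemma lintegral_rearrangement {f : (Fin n → ℝ) → ℝ} (hf : Integrable f) :
    ∫⁻ s in Ioi (0 : ℝ), rearrangement f s = ∫⁻ x, ‖f x‖ₑ := by
  simpa using lintegral_rearrangement_rpow hf one_pos

lemma rearrangement_mono {f g : (Fin n → ℝ) → ℝ} (h : ∀ᵐ x, ‖f x‖ₑ ≤ ‖g x‖ₑ) (t : ℝ) :
    rearrangement f t ≤ rearrangement g t := by
  rw [rearrangement_le_iff]
  refine le_trans (measure_mono_ae ?_) ((rearrangement_le_iff g t _).1 le_rfl)
  filter_upwards [h] with x hx hx'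
  exact lt_of_lt_of_le hx' hx

lemma rearrangement_eq_zero {f : (Fin n → ℝ) → ℝ} {t : ℝ}
    (h : volume (Function.support f) ≤ ENNReal.ofReal t) : rearrangement f t = 0 := by
  rw [← nonpos_iff_eq_zero, rearrangement_le_iff]
  refine le_trans (measure_mono fun x hx => ?_) h
  simpa using hx

/-- Hardy–Littlewood: `∫_A |f| ≤ ∫₀ᵗ f*` if `|A| ≤ t`. -/
lemma setLIntegral_le_lintegral_rearrangement {f : (Fin n → ℝ) → ℝ} (hf : Integrable f)
    {A : Set (Fin n → ℝ)} (hA : NullMeasurableSet A) {t : ℝ} (hAt : volume A ≤ ENNReal.ofReal t) :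
    ∫⁻ x in A, ‖f x‖ₑ ≤ ∫⁻ s in Ioo 0 t, rearrangement f s := by
  obtain ⟨B, hBA, hB, hAB⟩ := hA.exists_measurable_subset_ae_eq
  have hBt : volume B ≤ ENNReal.ofReal t := (measure_mono hBA).trans hAt
  -- The rearrangement of f χ_B lies below f* and lives on (0, t), while its total integral is that
  -- of |f| over B.
  have hzero : ∀ s, t ≤ s → rearrangement (B.indicator f) s = 0 := fun s hs =>
    rearrangement_eq_zero (((measure_mono (support_indicator_subset)).trans hBt).trans
      (ENNReal.ofReal_le_ofReal hs))
  calc ∫⁻ x in A, ‖f x‖ₑ = ∫⁻ x in B, ‖f x‖ₑ := (setLIntegral_congr hAB).symm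
    _ = ∫⁻ x, ‖B.indicator f x‖ₑ := by
      rw [← lintegral_indicator hB]
      simp only [enorm_indicator_eq_indicator_enorm]
    _ = ∫⁻ s in Ioi (0 : ℝ), rearrangement (B.indicator f) s :=
      (lintegral_rearrangement (hf.indicator hB)).symm
    _ ≤ ∫⁻ s in Ioi (0 : ℝ), (Ioo 0 t).indicator (rearrangement f) s := by
      refine setLIntegral_mono' measurableSet_Ioi fun s hs => ?_
      by_cases hst : s < t
      · rw [indicator_of_mem (show s ∈ Ioo 0 t from ⟨hs, hst⟩)]
        refine rearrangement_mono (Eventually.of_forall fun x => ?_) s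
        rw [enorm_indicator_eq_indicator_enorm]
        exact indicator_le_self _ _ _
      · rw [hzero s (not_lt.1 hst)]
        exact zero_le
    _ = ∫⁻ s in Ioo 0 t, rearrangement f s := by
      rw [setLIntegral_indicator measurableSet_Ioo, inter_eq_left.2 Ioo_subset_Ioi_self]

lemma lintegral_Ioo_rearrangement_le {f : (Fin n → ℝ) → ℝ} (hf : Integrable f) (t : ℝ) :
    ∫⁻ s in Ioo 0 t, rearrangement f s ≤ ∫⁻ x, ‖f x‖ₑ := by
  rw [← lintegral_rearrangement hf]
  exact lintegral_mono_set Ioo_subset_Ioi_self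

lemma lintegral_Ioo_rearrangement_ne_top {f : (Fin n → ℝ) → ℝ} (hf : Integrable f) (t : ℝ) :
    ∫⁻ s in Ioo 0 t, rearrangement f s ≠ ⊤ :=
  ne_top_of_le_ne_top hf.hasFiniteIntegral.ne (lintegral_Ioo_rearrangement_le hf t)

/-! ### Real-valued rearrangement and its primitive -/

/-- The decreasing rearrangement as a real function. -/
noncomputable def rearr (f : (Fin n → ℝ) → ℝ) (t : ℝ) : ℝ := (rearrangement f t).toReal

/-- The primitive `t ↦ ∫₀ᵗ f*` of the decreasing rearrangement. -/
noncomputable def primitive (f : (Fin n → ℝ) → ℝ) (t : ℝ) : ℝ := (∫⁻ s in Ioo 0 t, rearrangement f s).toReal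

lemma ofReal_rearr {f : (Fin n → ℝ) → ℝ} (hf : Integrable f) {t : ℝ} (ht : 0 < t) :
    ENNReal.ofReal (rearr f t) = rearrangement f t :=
  ENNReal.ofReal_toReal (rearrangement_ne_top hf ht)

lemma ofReal_primitive {f : (Fin n → ℝ) → ℝ} (hf : Integrable f) (t : ℝ) :
    ENNReal.ofReal (primitive f t) = ∫⁻ s in Ioo 0 t, rearrangement f s :=
  ENNReal.ofReal_toReal (lintegral_Ioo_rearrangement_ne_top hf t)

lemma rearr_nonneg (f : (Fin n → ℝ) → ℝ) (t : ℝ) : 0 ≤ rearr f t := ENNReal.toReal_nonneg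

lemma primitive_nonneg (f : (Fin n → ℝ) → ℝ) (t : ℝ) : 0 ≤ primitive f t := ENNReal.toReal_nonneg

lemma rearr_antitone {f : (Fin n → ℝ) → ℝ} (hf : Integrable f) {s t : ℝ} (hs : 0 < s)
    (hst : s ≤ t) : rearr f t ≤ rearr f s :=
  ENNReal.toReal_mono (rearrangement_ne_top hf hs) (rearrangement_antitone f hst)

lemma primitive_mono {f : (Fin n → ℝ) → ℝ} (hf : Integrable f) : Monotone (primitive f) :=
  fun _ t hst => ENNReal.toReal_mono (lintegral_Ioo_rearrangement_ne_top hf t)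
    (lintegral_mono_set (Ioo_subset_Ioo_right hst))

lemma lt_rearr_iff {f : (Fin n → ℝ) → ℝ} (hf : Integrable f) {t : ℝ} (ht : 0 < t) {s : ℝ}
    (hs : 0 ≤ s) :
    s < rearr f t ↔ ENNReal.ofReal t < distribution f (ENNReal.ofReal s) := by
  rw [← lt_rearrangement_iff, ← ofReal_rearr hf ht,
    ENNReal.ofReal_lt_ofReal_iff_of_nonneg hs]

lemma mul_rearr_le_primitive {f : (Fin n → ℝ) → ℝ} (hf : Integrable f) {t : ℝ} (ht : 0 < t) :
    t * rearr f t ≤ primitive f t := by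
  rw [← ENNReal.ofReal_le_ofReal_iff (primitive_nonneg f t), ofReal_primitive hf,
    ENNReal.ofReal_mul ht.le, ofReal_rearr hf ht]
  calc ENNReal.ofReal t * rearrangement f t = ∫⁻ _ in Ioo 0 t, rearrangement f t := by
        rw [setLIntegral_const, Real.volume_Ioo, sub_zero, mul_comm]
    _ ≤ _ := setLIntegral_mono' measurableSet_Ioo fun s hs => rearrangement_antitone f hs.2.le

lemma primitive_le_add {f : (Fin n → ℝ) → ℝ} (hf : Integrable f) {s t : ℝ} (hs : 0 < s)
    (hst : s ≤ t) : primitive f t ≤ primitive f s + (t - s) * rearr f s := by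
  have h1 : 0 ≤ (t - s) * rearr f s := mul_nonneg (by linarith) (rearr_nonneg f s)
  rw [← ENNReal.ofReal_le_ofReal_iff (add_nonneg (primitive_nonneg f s) h1), ofReal_primitive hf,
    ENNReal.ofReal_add (primitive_nonneg f s) h1, ofReal_primitive hf,
    ENNReal.ofReal_mul (by linarith), ofReal_rearr hf hs]
  calc ∫⁻ u in Ioo 0 t, rearrangement f u
      ≤ ∫⁻ u in Ioo 0 s ∪ Ico s t, rearrangement f u :=
        lintegral_mono_set fun u hu => (lt_or_ge u s).imp (fun h => ⟨hu.1, h⟩) fun h => ⟨h, hu.2⟩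
    _ ≤ (∫⁻ u in Ioo 0 s, rearrangement f u) + ∫⁻ u in Ico s t, rearrangement f u :=
        lintegral_union_le _ _ _
    _ ≤ (∫⁻ u in Ioo 0 s, rearrangement f u) + ∫⁻ _ in Ico s t, rearrangement f s := by
        refine add_le_add le_rfl ?_
        exact setLIntegral_mono' measurableSet_Ico fun u hu => rearrangement_antitone f hu.1
    _ = _ := by rw [setLIntegral_const, Real.volume_Ico, mul_comm]

/-! ### Integrals of powers -/

lemma lintegral_Ioo_rpow {a t : ℝ} (ha : 0 < a) (ht : 0 < t) :
    ∫⁻ s in Ioo 0 t, ENNReal.ofReal (s ^ (a - 1)) = ENNReal.ofReal (t ^ a / a) := by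
  have hint : IntervalIntegrable (fun s : ℝ => s ^ (a - 1)) volume 0 t :=
    intervalIntegral.intervalIntegrable_rpow' (by linarith)
  have hval : ∫ s in (0 : ℝ)..t, s ^ (a - 1) = t ^ a / a := by
    rw [integral_rpow (Or.inl (by linarith)), sub_add_cancel, Real.zero_rpow ha.ne', sub_zero]
  rw [← hval, intervalIntegral.integral_of_le ht.le, ofReal_integral_eq_lintegral_ofReal
      ((intervalIntegrable_iff_integrableOn_Ioc_of_le ht.le).1 hint)
      ((ae_restrict_iff' measurableSet_Ioc).2 (Eventually.of_forall fun s hs =>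
        Real.rpow_nonneg hs.1.le _))]
  exact setLIntegral_congr Ioo_ae_eq_Ioc

lemma lintegral_Ioi_rpow {a t : ℝ} (ha : 0 < a) (ht : 0 < t) :
    ∫⁻ s in Ioi t, ENNReal.ofReal (s ^ (-a - 1)) = ENNReal.ofReal (t ^ (-a) / a) := by
  have hval : ∫ s in Ioi t, s ^ (-a - 1) = t ^ (-a) / a := by
    rw [integral_Ioi_rpow_of_lt (by linarith) ht, sub_add_cancel, neg_div_neg_eq]
  rw [← hval, ofReal_integral_eq_lintegral_ofReal
    (integrableOn_Ioi_rpow_of_lt (by linarith) ht)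
    ((ae_restrict_iff' measurableSet_Ioi).2 (Eventually.of_forall fun s hs =>
        Real.rpow_nonneg (ht.le.trans (le_of_lt hs)) _))]

lemma lintegral_Ioo_inv {a b : ℝ} (ha : 0 < a) (hab : a ≤ b) :
    ∫⁻ s in Ioo a b, ENNReal.ofReal s⁻¹ = ENNReal.ofReal (Real.log (b / a)) := by
  have h0 : (0 : ℝ) ∉ uIcc a b := by
    rw [uIcc_of_le hab]
    exact fun h => absurd h.1 (not_le.2 ha)
  have hint : IntervalIntegrable (fun s : ℝ => s⁻¹) volume a b :=
    intervalIntegral.intervalIntegrable_inv (fun s hs => fun h => h0 (h ▸ hs)) continuousOn_id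
  rw [← integral_inv h0, intervalIntegral.integral_of_le hab, ofReal_integral_eq_lintegral_ofReal
      ((intervalIntegrable_iff_integrableOn_Ioc_of_le hab).1 hint)
      ((ae_restrict_iff' measurableSet_Ioc).2 (Eventually.of_forall fun s hs =>
        inv_nonneg.2 (ha.trans hs.1).le))]
  exact setLIntegral_congr Ioo_ae_eq_Ioc

/-- Integration of M s^(-1/p), which converges at 0 because p > 1. This is how weak-type bounds on
f* become bounds on f**. -/
lemma primitive_le_of_rearr_le {f : (Fin n → ℝ) → ℝ} (hf : Integrable f) {p M t : ℝ} (hp : 1 < p)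
    (hM : 0 ≤ M) (ht : 0 < t) (h : ∀ s, 0 < s → s < t → rearr f s * s ^ (1 / p) ≤ M) :
    primitive f t ≤ M * (t ^ (1 - 1 / p) / (1 - 1 / p)) := by
  have hp' : 0 < 1 - 1 / p := by
    rw [sub_pos, div_lt_one (by linarith)]
    exact hp
  rw [← ENNReal.ofReal_le_ofReal_iff (by positivity), ofReal_primitive hf, ENNReal.ofReal_mul hM,
    ← lintegral_Ioo_rpow hp' ht, ← lintegral_const_mul' _ _ ENNReal.ofReal_ne_top]
  refine setLIntegral_mono' measurableSet_Ioo fun s hs => ?_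
  rw [← ofReal_rearr hf hs.1, ← ENNReal.ofReal_mul hM]
  refine ENNReal.ofReal_le_ofReal ?_
  rw [show 1 - 1 / p - 1 = -(1 / p) by ring, Real.rpow_neg hs.1.le, ← div_eq_mul_inv,
    le_div_iff₀ (Real.rpow_pos_of_pos hs.1 _)]
  exact h s hs.1 hs.2

/-! ### Stopping cubes and the covering argument -/

/-- A ball of radius `ρ` can be moved inside `closedBall c R` so that it still contains the
intersection of the original one with `closedBall c R`. -/
lemma exists_inner_center (c x : Fin n → ℝ) {ρ R : ℝ} (hρ : 0 ≤ ρ) (hρR : ρ ≤ R) :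
    ∃ y, dist y c ≤ R - ρ ∧ ∀ z, dist z c ≤ R → dist z x ≤ ρ → dist z y ≤ ρ := by
  -- Balls of the sup metric are cubes, so it suffices to clamp each coordinate of x to [c i - (R -
  -- ρ), c i + (R - ρ)].
  refine ⟨fun i => max (c i - (R - ρ)) (min (x i) (c i + (R - ρ))), ?_, fun z hzc hzx => ?_⟩
  · refine (dist_pi_le_iff (by linarith)).2 fun i => ?_
    rw [Real.dist_eq, abs_le]
    constructor
    · linarith [le_max_left (c i - (R - ρ)) (min (x i) (c i + (R - ρ)))]
    · have : max (c i - (R - ρ)) (min (x i) (c i + (R - ρ))) ≤ c i + (R - ρ) :=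
        max_le (by linarith) (min_le_right _ _)
      linarith
  · refine (dist_pi_le_iff hρ).2 fun i => ?_
    have h1 := (dist_le_pi_dist z c i).trans hzc
    have h2 := (dist_le_pi_dist z x i).trans hzx
    rw [Real.dist_eq, abs_le] at h1 h2 ⊢
    rcases max_cases (c i - (R - ρ)) (min (x i) (c i + (R - ρ))) with h | h <;>
    rcases min_cases (x i) (c i + (R - ρ)) with h' | h' <;>
    constructor <;> linarith [h.1, h.2, h'.1, h'.2]

/-- The fivefold Vitali dilate may leave the big cube; it is shifted back inside, or replaced by the
whole cube when it is too large. The final alternative lets the stopping argument distinguish growth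
by a factor 5 from arrival at the whole cube. -/
lemma exists_enlargement (c y : Fin n → ℝ) {ρ R : ℝ} (hρ : 0 < ρ) (hy : dist y c ≤ R - ρ) :
    ∃ y' ρ', 0 < ρ' ∧ ρ' ≤ 5 * ρ ∧ dist y' c ≤ R - ρ' ∧
      closedBall c R ∩ closedBall y (5 * ρ) ⊆ closedBall y' ρ' ∧
      (ρ' = 5 * ρ ∨ (y' = c ∧ ρ' = R)) := by
  by_cases h : 5 * ρ ≤ R
  · obtain ⟨y', h1, h2⟩ := exists_inner_center c y (by linarith : 0 ≤ 5 * ρ) h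
    exact ⟨y', 5 * ρ, by linarith, le_rfl, h1, fun z hz => h2 z hz.1 hz.2, Or.inl rfl⟩
  · have hR : ρ ≤ R := by linarith [dist_nonneg (x := y) (y := c)]
    exact ⟨c, R, by linarith, by linarith, by simp, fun z hz => hz.1, Or.inr ⟨rfl, rfl⟩⟩

/-- A stopping-time selection: among the cubes inside `closedBall c R` containing `x` over which
the average of `|w|` exceeds `lam`, there is one whose enlargement has average at most `lam`. -/
lemma exists_stopping_ball {w : (Fin n → ℝ) → ℝ} {c x y₀ : Fin n → ℝ} {R ρ₀ : ℝ} {lam : ℝ≥0∞}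
    (hQ : ∫⁻ z in closedBall c R, ‖w z‖ₑ ≤ lam * volume (closedBall c R))
    (hρ₀ : 0 < ρ₀) (hy₀ : dist y₀ c ≤ R - ρ₀) (hx₀ : x ∈ closedBall y₀ ρ₀)
    (hw₀ : lam * volume (closedBall y₀ ρ₀) < ∫⁻ z in closedBall y₀ ρ₀, ‖w z‖ₑ) :
    ∃ y ρ, 0 < ρ ∧ dist y c ≤ R - ρ ∧ x ∈ closedBall y ρ ∧
      lam * volume (closedBall y ρ) < ∫⁻ z in closedBall y ρ, ‖w z‖ₑ ∧
      ∃ y' ρ', 0 < ρ' ∧ ρ' ≤ 5 * ρ ∧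
        closedBall c R ∩ closedBall y (5 * ρ) ⊆ closedBall y' ρ' ∧
        ∫⁻ z in closedBall y' ρ', ‖w z‖ₑ ≤ lam * volume (closedBall y' ρ') := by
  by_contra! hcon
  -- Without a stopping cube each enlargement is again admissible. It is never the whole cube, by
  -- `hQ`, so the radius gains a factor 5 each time although it is bounded by R.
  have key : ∀ k : ℕ, ∃ y ρ, ρ₀ * 5 ^ k ≤ ρ ∧ dist y c ≤ R - ρ ∧ x ∈ closedBall y ρ ∧
      lam * volume (closedBall y ρ) < ∫⁻ z in closedBall y ρ, ‖w z‖ₑ := by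
    intro k
    induction k with
    | zero => exact ⟨y₀, ρ₀, by simp, hy₀, hx₀, hw₀⟩
    | succ k ih =>
      obtain ⟨y, ρ, h1, h2, h3, h4⟩ := ih
      have hρ : 0 < ρ := lt_of_lt_of_le (by positivity) h1
      obtain ⟨y', ρ', g1, g2, g3, g4, g5⟩ := exists_enlargement c y hρ h2
      have g6 := hcon y ρ hρ h2 h3 h4 y' ρ' g1 g2 g4
      refine ⟨y', ρ', ?_, g3, g4 ⟨?_, ?_⟩, g6⟩
      · rcases g5 with rfl | ⟨rfl, rfl⟩
        · rw [pow_succ]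
          linarith
        · exact absurd hQ (not_le.2 g6)
      · exact closedBall_subset_closedBall' (by linarith) h3
      · exact closedBall_subset_closedBall (by linarith) h3
  obtain ⟨k, hk⟩ := pow_unbounded_of_one_lt (R / ρ₀) (by norm_num : (1 : ℝ) < 5)
  obtain ⟨y, ρ, h1, h2, -, -⟩ := key k
  rw [div_lt_iff₀ hρ₀] at hk
  linarith [dist_nonneg (x := y) (y := c), mul_comm ρ₀ (5 ^ k)]

/-- Lebesgue differentiation along cubes that contain x without being centred there: small cubes
around x are shifted into the big one by `exists_inner_center`. -/
lemma ae_exists_ball_average_gt {w : (Fin n → ℝ) → ℝ} (hw : LocallyIntegrable w volume)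
    (c : Fin n → ℝ) {R : ℝ} (hR : 0 < R) {lam : ℝ≥0∞} (hlam : lam ≠ ⊤) :
    ∀ᵐ x, x ∈ closedBall c R → lam < ‖w x‖ₑ →
      ∃ y ρ, 0 < ρ ∧ dist y c ≤ R - ρ ∧ x ∈ closedBall y ρ ∧
        lam * volume (closedBall y ρ) < ∫⁻ z in closedBall y ρ, ‖w z‖ₑ := by
  filter_upwards [IsUnifLocDoublingMeasure.ae_tendsto_average volume
    (f := fun z => ‖w z‖) (fun z => (hw z).imp fun s hs => ⟨hs.1, hs.2.norm⟩) 1] with x hx hxQ hlt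
  have hρ : ∀ k : ℕ, 0 < R / (k + 1) ∧ R / (k + 1) ≤ R := fun k =>
    ⟨by positivity, div_le_self hR.le (by linarith [(Nat.cast_nonneg k : (0 : ℝ) ≤ k)])⟩
  choose y hy1 hy2 using fun k : ℕ => exists_inner_center c x (hρ k).1.le (hρ k).2
  have hxy : ∀ k, x ∈ closedBall (y k) (R / (k + 1)) := fun k =>
    hy2 k x hxQ (by simpa using (hρ k).1.le)
  have hlim : Tendsto (fun k : ℕ => R / ((k : ℝ) + 1)) atTop (𝓝[>] 0) := by
    refine tendsto_nhdsWithin_iff.2 ⟨?_, Eventually.of_forall fun k => (hρ k).1⟩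
    simpa [div_eq_mul_inv] using (tendsto_one_div_add_atTop_nhds_zero_nat (𝕜 := ℝ)).const_mul R
  have hav := hx y (fun k : ℕ => R / ((k : ℝ) + 1)) hlim
    (Eventually.of_forall fun k => by simpa only [one_mul] using hxy k)
  have hlt' : lam.toReal < ‖w x‖ := by
    rwa [← ofReal_norm, ← ENNReal.ofReal_toReal hlam,
      ENNReal.ofReal_lt_ofReal_iff_of_nonneg ENNReal.toReal_nonneg] at hlt
  obtain ⟨k, hk⟩ := (hav.eventually (lt_mem_nhds hlt')).exists
  refine ⟨y k, R / (k + 1), (hρ k).1, hy1 k, hxy k, ?_⟩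
  have hint : IntegrableOn w (closedBall (y k) (R / (k + 1))) volume :=
    hw.integrableOn_isCompact (isCompact_closedBall _ _)
  have hvol : 0 < (volume (closedBall (y k) (R / ((k : ℝ) + 1)))).toReal :=
    ENNReal.toReal_pos (measure_closedBall_pos volume _ (hρ k).1).ne'
      measure_closedBall_lt_top.ne
  rw [setAverage_eq, smul_eq_mul, ← div_eq_inv_mul, measureReal_def, lt_div_iff₀ hvol] at hk
  rw [← ofReal_integral_norm_eq_lintegral_enorm hint, ← ENNReal.ofReal_toReal hlam,
    ← ENNReal.ofReal_toReal (measure_closedBall_lt_top (μ := volume) (x := y k)).ne,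
    ← ENNReal.ofReal_mul ENNReal.toReal_nonneg,
    ENNReal.ofReal_lt_ofReal_iff_of_nonneg (by positivity)]
  exact hk

lemma volume_closedBall_le_five_pow (y y' : Fin n → ℝ) {ρ ρ' : ℝ} (hρ' : 0 ≤ ρ') (h : ρ' ≤ 5 * ρ) :
    volume (closedBall y' ρ') ≤ 5 ^ n * volume (closedBall y ρ) := by
  rw [Real.volume_pi_closedBall _ hρ', Real.volume_pi_closedBall _ (by linarith),
    show (5 : ℝ≥0∞) = ENNReal.ofReal 5 by simp, ← ENNReal.ofReal_pow (by norm_num),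
    ← ENNReal.ofReal_mul (by positivity), Fintype.card_fin, ← mul_pow]
  exact ENNReal.ofReal_le_ofReal (pow_le_pow_left₀ (by positivity) (by linarith) n)

/-- A covering argument transfers a distributional estimate that holds over all cubes of average at
most `lam` to a fixed cube, with the volume of the cube replaced by that of the level set
of the local maximal function. -/
lemma volume_level_le_of_forall_ball {w : (Fin n → ℝ) → ℝ} (hw : LocallyIntegrable w volume)
    {lam τ κ t : ℝ≥0∞} (hlam : lam ≠ ⊤) (hτ : lam ≤ τ)
    (H : ∀ (c : Fin n → ℝ) (R : ℝ), 0 < R →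
      ∫⁻ z in closedBall c R, ‖w z‖ₑ ≤ lam * volume (closedBall c R) →
      volume {x | x ∈ closedBall c R ∧ τ < ‖w x‖ₑ} ≤ κ * volume (closedBall c R))
    (c : Fin n → ℝ) {R : ℝ} (hR : 0 < R)
    (hQ : ∫⁻ z in closedBall c R, ‖w z‖ₑ ≤ lam * volume (closedBall c R))
    (ht : ∀ U ⊆ closedBall c R, MeasurableSet U → t < volume U →
      ∫⁻ z in U, ‖w z‖ₑ ≤ lam * volume U) :
    volume {x | x ∈ closedBall c R ∧ τ < ‖w x‖ₑ} ≤ κ * (5 ^ n * t) := by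
  let T : Set ((Fin n → ℝ) × ℝ) := {b | 0 < b.2 ∧ dist b.1 c ≤ R - b.2 ∧
      lam * volume (closedBall b.1 b.2) < ∫⁻ z in closedBall b.1 b.2, ‖w z‖ₑ ∧
      ∃ y' ρ', 0 < ρ' ∧ ρ' ≤ 5 * b.2 ∧
        closedBall c R ∩ closedBall b.1 (5 * b.2) ⊆ closedBall y' ρ' ∧
        ∫⁻ z in closedBall y' ρ', ‖w z‖ₑ ≤ lam * volume (closedBall y' ρ')}
  obtain ⟨u, huT, hdisj, hcov⟩ := Vitali.exists_disjoint_subfamily_covering_enlargement_closedBall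
    T (fun b => b.1) (fun b => b.2) R
    (fun b hb => by linarith [hb.2.1, dist_nonneg (x := b.1) (y := c)]) 5 (by norm_num)
  have hcount : u.Countable := by
    refine hdisj.countable_of_nonempty_interior fun b hb => ?_
    exact ⟨b.1, ball_subset_interior_closedBall (mem_ball_self (huT hb).1)⟩
  have : Countable u := hcount.to_subtype
  choose y' ρ' hρ'0 hρ' hsub hav using fun b : u => (huT b.2).2.2.2
  -- Since `lam ≤ τ`, almost every point of the level set lies in a stopping cube, hence in the
  -- dilate of a selected cube, and so in the associated enlargement, where `H` applies.
  have hae : ∀ᵐ x, x ∈ {x | x ∈ closedBall c R ∧ τ < ‖w x‖ₑ} →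
      x ∈ ⋃ b : u, {x | x ∈ closedBall (y' b) (ρ' b) ∧ τ < ‖w x‖ₑ} := by
    filter_upwards [ae_exists_ball_average_gt hw c hR hlam] with x hx hxm
    obtain ⟨y₀, ρ₀, h1, h2, h3, h4⟩ := hx hxm.1 (lt_of_le_of_lt hτ hxm.2)
    obtain ⟨y, ρ, g1, g2, g3, g4, g5⟩ := exists_stopping_ball hQ h1 h2 h3 h4
    obtain ⟨b, hb, hsubb⟩ := hcov (y, ρ) ⟨g1, g2, g4, g5⟩
    exact mem_iUnion.2 ⟨⟨b, hb⟩, hsub ⟨b, hb⟩ ⟨hxm.1, hsubb g3⟩, hxm.2⟩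
  let U : Set (Fin n → ℝ) := ⋃ b : u, closedBall b.1.1 b.1.2
  have hUm : MeasurableSet U := MeasurableSet.iUnion fun b => isClosed_closedBall.measurableSet
  have hUQ : U ⊆ closedBall c R := iUnion_subset fun b =>
    closedBall_subset_closedBall' (by linarith [(huT b.2).2.1])
  have hdisj' : Pairwise (Function.onFun Disjoint fun b : u => closedBall b.1.1 b.1.2) :=
    fun a b hab => hdisj a.2 b.2 (Subtype.coe_injective.ne hab)
  have hUvol : volume U = ∑' b : u, volume (closedBall b.1.1 b.1.2) :=
    measure_iUnion hdisj' fun b => isClosed_closedBall.measurableSet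
  -- A disjoint union of cubes of average above `lam` has average above `lam`, which `ht` forbids
  -- for sets of measure greater than `t`.
  have hUt : volume U ≤ t := by
    by_contra! hlt
    have hle := ht U hUQ hUm hlt
    have hne : Nonempty u := by
      by_contra hemp
      rw [not_nonempty_iff] at hemp
      rw [hUvol, tsum_empty] at hlt
      exact not_lt_zero hlt
    have hfin : lam * volume U ≠ ⊤ := ENNReal.mul_ne_top hlam
      (ne_top_of_le_ne_top measure_closedBall_lt_top.ne (measure_mono hUQ))
    rw [hUvol, ← ENNReal.tsum_mul_left] at hfin
    have hstrict : ∀ b : u, lam * volume (closedBall b.1.1 b.1.2) <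
        ∫⁻ z in closedBall b.1.1 b.1.2, ‖w z‖ₑ := fun b => (huT b.2).2.2.1
    have hlt2 := ENNReal.tsum_lt_tsum hfin (fun b => (hstrict b).le) (hstrict hne.some)
    rw [lintegral_iUnion (fun b => isClosed_closedBall.measurableSet) hdisj', hUvol,
      ← ENNReal.tsum_mul_left] at hle
    exact absurd hlt2 (not_lt.2 hle)
  calc volume {x | x ∈ closedBall c R ∧ τ < ‖w x‖ₑ}
      ≤ volume (⋃ b : u, {x | x ∈ closedBall (y' b) (ρ' b) ∧ τ < ‖w x‖ₑ}) := measure_mono_ae hae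
    _ ≤ ∑' b : u, volume {x | x ∈ closedBall (y' b) (ρ' b) ∧ τ < ‖w x‖ₑ} := measure_iUnion_le _
    _ ≤ ∑' b : u, κ * (5 ^ n * volume (closedBall b.1.1 b.1.2)) := by
        refine ENNReal.tsum_le_tsum fun b => (H _ _ (hρ'0 b) (hav b)).trans ?_
        gcongr
        exact volume_closedBall_le_five_pow _ _ (hρ'0 b).le (hρ' b)
    _ = κ * (5 ^ n * volume U) := by
        rw [ENNReal.tsum_mul_left, ENNReal.tsum_mul_left, hUvol]
    _ ≤ κ * (5 ^ n * t) := by gcongr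

/-! ### Truncations to cubes and the scaled primitive -/

/-- The truncation of `w` to the cube with centre `c` and side `2R`. -/
noncomputable def cut (w : (Fin n → ℝ) → ℝ) (c : Fin n → ℝ) (R : ℝ) : (Fin n → ℝ) → ℝ :=
  (closedBall c R).indicator w

/-- The function `t ↦ t^(1/p) f**(t)`. -/
noncomputable def scaledPrimitive (p : ℝ) (f : (Fin n → ℝ) → ℝ) (t : ℝ) : ℝ :=
  primitive f t * t ^ (1 / p - 1)

lemma scaledPrimitive_nonneg (p : ℝ) (f : (Fin n → ℝ) → ℝ) {t : ℝ} (ht : 0 ≤ t) :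
    0 ≤ scaledPrimitive p f t :=
  mul_nonneg (primitive_nonneg f t) (Real.rpow_nonneg ht _)

lemma scaledPrimitive_eq (p : ℝ) (f : (Fin n → ℝ) → ℝ) {t : ℝ} (ht : 0 < t) :
    scaledPrimitive p f t = primitive f t / t * t ^ (1 / p) := by
  rw [scaledPrimitive, Real.rpow_sub_one ht.ne']
  ring

lemma rearr_mul_rpow_le_scaledPrimitive {f : (Fin n → ℝ) → ℝ} (hf : Integrable f) (p : ℝ) {t : ℝ}
    (ht : 0 < t) : rearr f t * t ^ (1 / p) ≤ scaledPrimitive p f t := by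
  rw [scaledPrimitive_eq p f ht]
  refine mul_le_mul_of_nonneg_right ?_ (Real.rpow_nonneg ht.le _)
  rw [le_div_iff₀ ht, mul_comm]
  exact mul_rearr_le_primitive hf ht

/-- f** is decreasing, because f*(t) ≤ f**(t). -/
lemma primitive_le_mul_div {f : (Fin n → ℝ) → ℝ} (hf : Integrable f) {t m : ℝ} (ht : 0 < t)
    (htm : t ≤ m) : primitive f m ≤ primitive f t / t * m := by
  have h1 := primitive_le_add hf ht htm
  have h2 : rearr f t ≤ primitive f t / t := by
    rw [le_div_iff₀ ht, mul_comm]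
    exact mul_rearr_le_primitive hf ht
  have h3 := mul_le_mul_of_nonneg_left h2 (sub_nonneg.2 htm)
  have h4 : (m - t) * (primitive f t / t) = primitive f t / t * m - primitive f t := by
    field_simp
  linarith

lemma volume_closedBall_eq (c : Fin n → ℝ) {R : ℝ} (hR : 0 < R) :
    volume (closedBall c R) = ENNReal.ofReal ((2 * R) ^ n) := by
  rw [Real.volume_pi_closedBall _ hR.le, Fintype.card_fin]

lemma integrable_cut {w : (Fin n → ℝ) → ℝ} (hw : LocallyIntegrable w volume) (c : Fin n → ℝ)
    (R : ℝ) : Integrable (cut w c R) :=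
  (hw.integrableOn_isCompact (isCompact_closedBall c R)).integrable_indicator
    isClosed_closedBall.measurableSet

lemma setLIntegral_cut {w : (Fin n → ℝ) → ℝ} (c : Fin n → ℝ) (R : ℝ) {U : Set (Fin n → ℝ)}
    (hU : MeasurableSet U) (hUQ : U ⊆ closedBall c R) :
    ∫⁻ x in U, ‖cut w c R x‖ₑ = ∫⁻ x in U, ‖w x‖ₑ :=
  setLIntegral_congr_fun hU fun x hx => by
    rw [cut, indicator_of_mem (hUQ hx)]

lemma lintegral_cut_rpow (w : (Fin n → ℝ) → ℝ) (c : Fin n → ℝ) (R : ℝ) {r : ℝ} (hr : 0 < r) :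
    ∫⁻ x, ‖cut w c R x‖ₑ ^ r = ∫⁻ x in closedBall c R, ‖w x‖ₑ ^ r := by
  rw [← lintegral_indicator isClosed_closedBall.measurableSet]
  refine lintegral_congr fun x => ?_
  by_cases hx : x ∈ closedBall c R
  · simp [cut, hx]
  · simp [cut, hx, hr]

lemma lintegral_cut (w : (Fin n → ℝ) → ℝ) (c : Fin n → ℝ) (R : ℝ) :
    ∫⁻ x, ‖cut w c R x‖ₑ = ∫⁻ x in closedBall c R, ‖w x‖ₑ := by
  simpa using lintegral_cut_rpow w c R one_pos

lemma ofReal_primitive_cut {w : (Fin n → ℝ) → ℝ} (hw : LocallyIntegrable w volume)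
    (c : Fin n → ℝ) {R : ℝ} (hR : 0 < R) :
    ENNReal.ofReal (primitive (cut w c R) ((2 * R) ^ n)) = ∫⁻ x in closedBall c R, ‖w x‖ₑ := by
  rw [ofReal_primitive (integrable_cut hw c R)]
  refine le_antisymm ?_ ?_
  · rw [← lintegral_cut]
    exact lintegral_Ioo_rearrangement_le (integrable_cut hw c R) _
  · rw [← setLIntegral_cut c R isClosed_closedBall.measurableSet le_rfl]
    exact setLIntegral_le_lintegral_rearrangement (integrable_cut hw c R)
      isClosed_closedBall.measurableSet.nullMeasurableSet (volume_closedBall_eq c hR).le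

lemma primitive_cut_le {w : (Fin n → ℝ) → ℝ} (hw : LocallyIntegrable w volume)
    (c : Fin n → ℝ) {R : ℝ} (hR : 0 < R) (t : ℝ) :
    primitive (cut w c R) t ≤ primitive (cut w c R) ((2 * R) ^ n) := by
  rw [← ENNReal.ofReal_le_ofReal_iff (primitive_nonneg _ _), ofReal_primitive_cut hw c hR,
    ofReal_primitive (integrable_cut hw c R), ← lintegral_cut]
  exact lintegral_Ioo_rearrangement_le (integrable_cut hw c R) _

lemma distribution_cut (w : (Fin n → ℝ) → ℝ) (c : Fin n → ℝ) (R : ℝ) (s : ℝ≥0∞) :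
    distribution (cut w c R) s = volume {x | x ∈ closedBall c R ∧ s < ‖w x‖ₑ} := by
  rw [distribution]
  congr 1
  ext x
  by_cases hx : x ∈ closedBall c R
  · simp only [cut, mem_ofPred_eq, indicator_of_mem hx, hx, true_and]
  · simp only [cut, mem_ofPred_eq, indicator_of_notMem hx, hx, false_and, enorm_zero, not_lt_zero]

/-! ### Localisation of weak-type bounds -/

/-- A weak-type bound at small scales, uniform over cubes, gives a bound for the distribution
function over every cube of average at most `lam`. -/
lemma volume_level_le_of_rearr_le {w : (Fin n → ℝ) → ℝ} (hw : LocallyIntegrable w volume)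
    {p B δ : ℝ} (hp : 1 < p) (hB : 0 < B) (hδ : 0 < δ)
    (h : ∀ (c : Fin n → ℝ) (R : ℝ), 0 < R → ∀ s, 0 < s → s < δ * (2 * R) ^ n →
      rearr (cut w c R) s * s ^ (1 / p) ≤ B * scaledPrimitive p (cut w c R) ((2 * R) ^ n))
    {lam τ : ℝ} (hlam : 0 < lam) (hτ : lam / δ ≤ τ) (c : Fin n → ℝ) {R : ℝ} (hR : 0 < R)
    (hQ : ∫⁻ z in closedBall c R, ‖w z‖ₑ ≤ ENNReal.ofReal lam * volume (closedBall c R)) :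
    volume {x | x ∈ closedBall c R ∧ ENNReal.ofReal τ < ‖w x‖ₑ} ≤
      ENNReal.ofReal ((B * lam / τ) ^ p) * volume (closedBall c R) := by
  have hτ0 : 0 < τ := lt_of_lt_of_le (by positivity) hτ
  have hp0 : 0 < p := by linarith
  have hf := integrable_cut hw c R
  have hV : 0 < (2 * R) ^ n := by positivity
  set V := (2 * R) ^ n with hVdef
  set f := cut w c R with hfdef
  rw [← distribution_cut, volume_closedBall_eq c hR, ← ENNReal.ofReal_mul (by positivity)]
  have hF : primitive f V ≤ lam * V := by
    rw [← ENNReal.ofReal_le_ofReal_iff (by positivity), ofReal_primitive_cut hw c hR,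
      ENNReal.ofReal_mul hlam.le, ← volume_closedBall_eq c hR]
    exact hQ
  -- Chebyshev with τ ≥ lam / δ: any s below the distribution at τ then satisfies s < δV, where `h`
  -- is available.
  have hD : distribution f (ENNReal.ofReal τ) ≤ ENNReal.ofReal (δ * V) := by
    have h1 := mul_distribution_le hf (ENNReal.ofReal τ)
    rw [lintegral_cut] at h1
    have h2 : ENNReal.ofReal τ * distribution f (ENNReal.ofReal τ) ≤
        ENNReal.ofReal τ * ENNReal.ofReal (δ * V) := by
      refine (h1.trans hQ).trans ?_
      rw [volume_closedBall_eq c hR, ← ENNReal.ofReal_mul hlam.le, ← ENNReal.ofReal_mul hτ0.le]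
      refine ENNReal.ofReal_le_ofReal ?_
      rw [div_le_iff₀ hδ] at hτ
      nlinarith
    exact (ENNReal.mul_le_mul_iff_right (by simpa using hτ0) ENNReal.ofReal_ne_top).1 h2
  by_contra! hcon
  obtain ⟨e, he1, he2⟩ := exists_between hcon
  have hetop : e ≠ ⊤ := ne_top_of_lt he2
  obtain ⟨s, hs0, rfl⟩ : ∃ s : ℝ, 0 ≤ s ∧ e = ENNReal.ofReal s :=
    ⟨e.toReal, ENNReal.toReal_nonneg, (ENNReal.ofReal_toReal hetop).symm⟩
  rw [ENNReal.ofReal_lt_ofReal_iff_of_nonneg (by positivity)] at he1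
  have hs : 0 < s := lt_of_le_of_lt (by positivity) he1
  have hsV : s < δ * V := by
    rw [← ENNReal.ofReal_lt_ofReal_iff_of_nonneg hs0]
    exact he2.trans_le hD
  have hg : τ < rearr f s := (lt_rearr_iff hf hs hτ0.le).2 he2
  have h1 := h c R hR s hs hsV
  have h2 : B * scaledPrimitive p f V ≤ B * (lam * V ^ (1 / p)) := by
    rw [scaledPrimitive_eq p f hV]
    gcongr
    rwa [div_le_iff₀ hV]
  have h3 : τ * s ^ (1 / p) < B * (lam * V ^ (1 / p)) :=
    lt_of_lt_of_le (mul_lt_mul_of_pos_right hg (Real.rpow_pos_of_pos hs _)) (h1.trans h2)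
  have h4 : s ^ (1 / p) < B * lam / τ * V ^ (1 / p) := by
    rw [div_mul_eq_mul_div, lt_div_iff₀ hτ0]
    linarith
  have h5 := Real.rpow_lt_rpow (by positivity) h4 hp0
  rw [Real.mul_rpow (by positivity) (by positivity), ← Real.rpow_mul hs0, ← Real.rpow_mul hV.le,
    one_div_mul_cancel hp0.ne', Real.rpow_one, Real.rpow_one] at h5
  linarith

/-- A weak-type bound at small scales, uniform over cubes, passes from the full measure of the cube
to every smaller `t`. -/
lemma rearr_le_scaledPrimitive_of_forall_cube {w : (Fin n → ℝ) → ℝ}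
    (hw : LocallyIntegrable w volume)
    {p B δ δ' : ℝ} (hp : 1 < p) (hB : 0 < B) (hδ : 0 < δ) (hδ1 : δ ≤ 1)
    (h : ∀ (c : Fin n → ℝ) (R : ℝ), 0 < R → ∀ s, 0 < s → s < δ * (2 * R) ^ n →
      rearr (cut w c R) s * s ^ (1 / p) ≤ B * scaledPrimitive p (cut w c R) ((2 * R) ^ n))
    (hδ'0 : 0 ≤ δ') (hδ'1 : δ' ≤ 1) (hδ' : δ' ^ (1 / p) ≤ (5 ^ n) ^ (1 / p) * B * δ)
    (c : Fin n → ℝ) {R : ℝ} (hR : 0 < R) {t : ℝ} (ht : 0 < t) (htV : t ≤ (2 * R) ^ n)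
    {s : ℝ} (hs : 0 < s) (hst : s < δ' * t) :
    rearr (cut w c R) s * s ^ (1 / p) ≤
      (5 ^ n) ^ (1 / p) * B * scaledPrimitive p (cut w c R) t := by
  have hp0 : 0 < p := by linarith
  have hf := integrable_cut hw c R
  have hst' : s ≤ t := hst.le.trans (mul_le_of_le_one_left ht.le hδ'1)
  rw [scaledPrimitive_eq p _ ht]
  have hlam0 : 0 ≤ primitive (cut w c R) t / t := div_nonneg (primitive_nonneg _ _) ht.le
  -- If f**(t) = 0 then f*(s) = 0 as well; otherwise f**(t) is the level for the stopping argument.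
  rcases hlam0.eq_or_lt with hlam | hlam
  · have h0 : primitive (cut w c R) t = 0 := by
      rcases (div_eq_zero_iff.1 hlam.symm) with h0 | h0
      · exact h0
      · exact absurd h0 ht.ne'
    have h1 := (mul_rearr_le_primitive hf hs).trans (primitive_mono hf hst')
    rw [h0] at h1
    have h2 : rearr (cut w c R) s = 0 :=
      le_antisymm (nonpos_of_mul_nonpos_right h1 hs) (rearr_nonneg _ _)
    rw [h2, ← hlam]
    simp
  have hQF : ∫⁻ z in closedBall c R, ‖w z‖ₑ ≤
      ENNReal.ofReal (primitive (cut w c R) t / t) * volume (closedBall c R) := by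
    rw [volume_closedBall_eq c hR, ← ofReal_primitive_cut hw c hR, ← ENNReal.ofReal_mul hlam0]
    exact ENNReal.ofReal_le_ofReal (primitive_le_mul_div hf ht htV)
  -- By Hardy–Littlewood the average over U is at most f**(|U|), which is at most f**(t) once |U| >
  -- t.
  have hU : ∀ U ⊆ closedBall c R, MeasurableSet U → ENNReal.ofReal t < volume U →
      ∫⁻ z in U, ‖w z‖ₑ ≤ ENNReal.ofReal (primitive (cut w c R) t / t) * volume U := by
    intro U hUQ hUm hUt
    have hfin : volume U ≠ ⊤ :=
      ne_top_of_le_ne_top measure_closedBall_lt_top.ne (measure_mono hUQ)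
    obtain ⟨m, hm0, hm⟩ : ∃ m : ℝ, 0 ≤ m ∧ volume U = ENNReal.ofReal m :=
      ⟨_, ENNReal.toReal_nonneg, (ENNReal.ofReal_toReal hfin).symm⟩
    rw [hm, ENNReal.ofReal_lt_ofReal_iff_of_nonneg ht.le] at hUt
    rw [← setLIntegral_cut c R hUm hUQ, hm, ← ENNReal.ofReal_mul hlam0]
    refine (setLIntegral_le_lintegral_rearrangement hf hUm.nullMeasurableSet hm.le).trans ?_
    rw [← ofReal_primitive hf]
    exact ENNReal.ofReal_le_ofReal (primitive_le_mul_div hf ht hUt.le)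
  set lam := primitive (cut w c R) t / t
  set f := cut w c R with hfdef
  set N : ℝ := (5 ^ n) ^ (1 / p) with hN
  have hN0 : 0 < N := by positivity
  have key : ∀ τ, 0 < τ → τ < rearr f s → τ * s ^ (1 / p) ≤ N * B * (lam * t ^ (1 / p)) := by
    intro τ hτ0 hτ
    -- Low heights are harmless because s < δ' t, with `hδ'` calibrated for this; high heights need
    -- the covering estimate, whose factor 5^n becomes N after taking the p-th root.
    rcases lt_or_ge τ (lam / δ) with hlt | hge
    · calc τ * s ^ (1 / p) ≤ lam / δ * (δ' * t) ^ (1 / p) := by gcongr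
        _ = δ' ^ (1 / p) * (lam * t ^ (1 / p)) / δ := by
          rw [Real.mul_rpow hδ'0 ht.le]
          ring
        _ ≤ N * B * δ * (lam * t ^ (1 / p)) / δ := by gcongr
        _ = N * B * (lam * t ^ (1 / p)) := by field_simp
    · have hle : lam ≤ τ := le_trans (by rw [le_div_iff₀ hδ]; nlinarith) hge
      have hD := volume_level_le_of_forall_ball hw ENNReal.ofReal_ne_top
        (ENNReal.ofReal_le_ofReal hle)
        (fun c' R' hR' hQ' => volume_level_le_of_rearr_le hw hp hB hδ h hlam hge c' hR' hQ')
        c hR hQF hU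
      rw [← distribution_cut] at hD
      have h1 := ((lt_rearr_iff hf hs hτ0.le).1 hτ).trans_le hD
      rw [show (5 : ℝ≥0∞) = ENNReal.ofReal 5 by simp, ← ENNReal.ofReal_pow (by norm_num),
        ← ENNReal.ofReal_mul (by positivity), ← ENNReal.ofReal_mul (by positivity),
        ENNReal.ofReal_lt_ofReal_iff_of_nonneg hs.le] at h1
      have h2 := Real.rpow_le_rpow hs.le h1.le (by positivity : 0 ≤ 1 / p)
      rw [Real.mul_rpow (by positivity) (by positivity), Real.mul_rpow (by positivity) ht.le,
        ← Real.rpow_mul (by positivity), mul_one_div_cancel hp0.ne', Real.rpow_one] at h2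
      calc τ * s ^ (1 / p) ≤ τ * (B * lam / τ * (N * t ^ (1 / p))) := by gcongr
        _ = N * B * (lam * t ^ (1 / p)) := by field_simp
  have hs' : 0 < s ^ (1 / p) := Real.rpow_pos_of_pos hs _
  rw [← le_div_iff₀ hs']
  refine le_of_forall_lt fun τ hτ => ?_
  by_contra! hcon
  obtain ⟨τ', h1, h2⟩ := exists_between hτ
  have h3 : 0 ≤ N * B * (lam * t ^ (1 / p)) / s ^ (1 / p) := by positivity
  have h4 := key τ' (by linarith) h2
  rw [← le_div_iff₀ hs'] at h4
  linarith

/-! ### Self-improvement: from an integral bound to power decay -/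

lemma one_sub_inv_pos {p : ℝ} (hp : 1 < p) : 0 < 1 - 1 / p := by
  rw [sub_pos, div_lt_one (by linarith)]
  exact hp

lemma primitive_eq_scaledPrimitive_mul (p : ℝ) (f : (Fin n → ℝ) → ℝ) {t : ℝ} (ht : 0 < t) :
    primitive f t = scaledPrimitive p f t * t ^ (1 - 1 / p) := by
  rw [scaledPrimitive, mul_assoc, ← Real.rpow_add ht, show 1 / p - 1 + (1 - 1 / p) = 0 by ring,
    Real.rpow_zero, mul_one]

lemma scaledPrimitive_le_of_rearr_le {f : (Fin n → ℝ) → ℝ} (hf : Integrable f) {p M t : ℝ}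
    (hp : 1 < p) (hM : 0 ≤ M) (ht : 0 < t)
    (h : ∀ s, 0 < s → s < t → rearr f s * s ^ (1 / p) ≤ M) :
    scaledPrimitive p f t ≤ M / (1 - 1 / p) := by
  have h1 := primitive_le_of_rearr_le hf hp hM ht h
  rw [primitive_eq_scaledPrimitive_mul p f ht, mul_div_assoc', mul_div_right_comm] at h1
  exact le_of_mul_le_mul_right h1 (Real.rpow_pos_of_pos ht _)

/-- An integral bound for `s^(1/p) f*(s)` implies the pointwise one. -/
lemma rearr_mul_rpow_le_of_lintegral_le {f : (Fin n → ℝ) → ℝ} (hf : Integrable f)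
    {p r C M s V : ℝ} (hp : 1 < p) (hr : 0 < r) (hC : 0 ≤ C) (hM : 0 ≤ M)
    (h : ∫⁻ u in Ioo 0 V, ENNReal.ofReal ((rearr f u * u ^ (1 / p)) ^ r / u) ≤
      ENNReal.ofReal (C * M ^ r)) (hs : 0 < s) (hsV : s < V) :
    rearr f s * s ^ (1 / p) ≤ 2 ^ (1 / p) * (2 * C) ^ (1 / r) * M := by
  have hg := rearr_nonneg f s
  have hs2 : 0 < s / 2 := by positivity
  -- On (s/2, s) one has f* ≥ f*(s), so this interval alone contributes a fixed multiple of (s^(1/p)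
  -- f*(s))^r.
  have h1 : ENNReal.ofReal ((rearr f s * (s / 2) ^ (1 / p)) ^ r / s * (s / 2)) ≤
      ENNReal.ofReal (C * M ^ r) := by
    refine le_trans ?_ h
    refine le_trans ?_ (lintegral_mono_set (Ioo_subset_Ioo hs2.le hsV.le))
    calc ENNReal.ofReal ((rearr f s * (s / 2) ^ (1 / p)) ^ r / s * (s / 2))
        = ∫⁻ _ in Ioo (s / 2) s, ENNReal.ofReal ((rearr f s * (s / 2) ^ (1 / p)) ^ r / s) := by
          rw [setLIntegral_const, Real.volume_Ioo, ENNReal.ofReal_mul (by positivity), sub_half]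
      _ ≤ _ := by
          refine setLIntegral_mono' measurableSet_Ioo fun u hu => ENNReal.ofReal_le_ofReal ?_
          have hu0 : 0 < u := hs2.trans hu.1
          have := rearr_antitone hf hu0 hu.2.le
          have h2 := hu.1.le
          have h3 := hu.2.le
          have hgu := rearr_nonneg f u
          gcongr
  rw [ENNReal.ofReal_le_ofReal_iff (by positivity)] at h1
  have h2 : (rearr f s * (s / 2) ^ (1 / p)) ^ r ≤ 2 * C * M ^ r := by
    have : (rearr f s * (s / 2) ^ (1 / p)) ^ r / s * (s / 2) =
        (rearr f s * (s / 2) ^ (1 / p)) ^ r / 2 := by field_simp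
    linarith
  have h3 := Real.rpow_le_rpow (by positivity) h2 (by positivity : 0 ≤ 1 / r)
  rw [← Real.rpow_mul (by positivity), mul_one_div_cancel hr.ne', Real.rpow_one,
    Real.mul_rpow (by positivity) (by positivity), ← Real.rpow_mul hM,
    mul_one_div_cancel hr.ne', Real.rpow_one, Real.div_rpow hs.le (by norm_num)] at h3
  have h4 : 0 < (2 : ℝ) ^ (1 / p) := by positivity
  calc rearr f s * s ^ (1 / p) = 2 ^ (1 / p) * (rearr f s * (s ^ (1 / p) / 2 ^ (1 / p))) := by
        field_simp
    _ ≤ 2 ^ (1 / p) * ((2 * C) ^ (1 / r) * M) := by gcongr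
    _ = _ := by ring

/-- If `s^(1/p) f**(s)` is quasi-increasing, then it is controlled by `s^(1/p) f*(s)`
at a comparable scale. -/
lemma scaledPrimitive_le_rearr {f : (Fin n → ℝ) → ℝ} (hf : Integrable f) {p B κ t : ℝ}
    (hκ : 0 < κ) (hκ1 : κ ≤ 1) (hBκ : B * κ ^ (1 - 1 / p) ≤ 1 / 2) (ht : 0 < t)
    (h : scaledPrimitive p f (κ * t) ≤ B * scaledPrimitive p f t) :
    scaledPrimitive p f t ≤ 2 / κ ^ (1 / p) * (rearr f (κ * t) * (κ * t) ^ (1 / p)) := by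
  have hκt : 0 < κ * t := by positivity
  have hg := rearr_nonneg f (κ * t)
  have hφ := scaledPrimitive_nonneg p f ht.le
  -- At most half of F(t) comes from (0, κt); the rest comes from (κt, t), where f* ≤ f*(κt).
  have h1 : primitive f (κ * t) ≤ 1 / 2 * primitive f t := by
    rw [primitive_eq_scaledPrimitive_mul p f hκt, primitive_eq_scaledPrimitive_mul p f ht]
    calc scaledPrimitive p f (κ * t) * (κ * t) ^ (1 - 1 / p)
        ≤ B * scaledPrimitive p f t * (κ * t) ^ (1 - 1 / p) := by gcongr
      _ = B * κ ^ (1 - 1 / p) * (scaledPrimitive p f t * t ^ (1 - 1 / p)) := by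
        rw [Real.mul_rpow hκ.le ht.le]
        ring
      _ ≤ _ := by gcongr
  have h2 := primitive_le_add hf hκt (mul_le_of_le_one_left ht.le hκ1)
  have h3 : primitive f t / t ≤ 2 * rearr f (κ * t) := by
    rw [div_le_iff₀ ht]
    nlinarith [mul_nonneg hκt.le hg]
  rw [scaledPrimitive_eq p f ht, Real.mul_rpow hκ.le ht.le]
  have h4 : 0 < κ ^ (1 / p) := by positivity
  calc primitive f t / t * t ^ (1 / p) ≤ 2 * rearr f (κ * t) * t ^ (1 / p) := by gcongr
    _ = _ := by field_simp

/-- A quasi-increasing `s^(1/p) f**(s)` decays logarithmically under an integral bound. -/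
lemma rpow_mul_log_le {f : (Fin n → ℝ) → ℝ} (hf : Integrable f) {p r B κ C M V s : ℝ}
    (hr : 0 < r) (hB : 0 < B) (hκ : 0 < κ) (hκ1 : κ ≤ 1) (hBκ : B * κ ^ (1 - 1 / p) ≤ 1 / 2)
    (hCM : 0 ≤ C * M ^ r)
    (h : ∫⁻ u in Ioo 0 V, ENNReal.ofReal ((rearr f u * u ^ (1 / p)) ^ r / u) ≤
      ENNReal.ofReal (C * M ^ r))
    (hφ : ∀ s t, 0 < s → s ≤ t → t ≤ V → scaledPrimitive p f s ≤ B * scaledPrimitive p f t)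
    (hs : 0 < s) (hsV : s ≤ V) :
    scaledPrimitive p f s ^ r * Real.log (V / s) ≤
      (B * (2 / κ ^ (1 / p))) ^ r * (C * M ^ r) := by
  have hV : 0 < V := hs.trans_le hsV
  have hφs := scaledPrimitive_nonneg p f hs.le
  have hc : 0 < B * (2 / κ ^ (1 / p)) := by positivity
  -- For u in (κs, κV), φ(s) ≤ B φ(u/κ) is bounded by a multiple of u^(1/p) f*(u). Integrating the
  -- r-th power against du/u over this interval produces the logarithm.
  have hlog : Real.log (V / s) = Real.log (κ * V / (κ * s)) := by
    rw [mul_div_mul_left _ _ hκ.ne']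
  rw [← ENNReal.ofReal_le_ofReal_iff (by positivity), hlog,
    ENNReal.ofReal_mul (by positivity), ENNReal.ofReal_mul (by positivity),
    ← lintegral_Ioo_inv (by positivity) (by gcongr)]
  refine le_trans ?_ (mul_le_mul_right h _)
  rw [← lintegral_const_mul' _ _ ENNReal.ofReal_ne_top,
    ← lintegral_const_mul' _ _ ENNReal.ofReal_ne_top]
  refine le_trans ?_ (lintegral_mono_set
    (Ioo_subset_Ioo (by positivity : 0 ≤ κ * s) (mul_le_of_le_one_left hV.le hκ1)))
  refine setLIntegral_mono' measurableSet_Ioo fun u hu => ?_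
  have hu0 : 0 < u := lt_trans (by positivity) hu.1
  have hg := rearr_nonneg f u
  rw [← ENNReal.ofReal_mul (by positivity), ← ENNReal.ofReal_mul (by positivity)]
  refine ENNReal.ofReal_le_ofReal ?_
  have hsu : s ≤ u / κ := by
    rw [le_div_iff₀ hκ, mul_comm]
    exact hu.1.le
  have huV : u / κ ≤ V := by
    rw [div_le_iff₀ hκ, mul_comm]
    exact hu.2.le
  have hκu : κ * (u / κ) = u := by field_simp
  have h1 := scaledPrimitive_le_rearr hf hκ hκ1 hBκ (by positivity : 0 < u / κ)
    (hφ (κ * (u / κ)) (u / κ) (by positivity) (mul_le_of_le_one_left (by positivity) hκ1) huV)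
  rw [hκu] at h1
  have h2 : scaledPrimitive p f s ≤ B * (2 / κ ^ (1 / p)) * (rearr f u * u ^ (1 / p)) := by
    rw [mul_assoc]
    exact (hφ s (u / κ) hs hsu huV).trans (by gcongr)
  rw [← div_eq_mul_inv, ← mul_div_assoc, ← Real.mul_rpow (by positivity) (by positivity)]
  gcongr

/-- Halving is iterated k times, where δ^(k+1) < s/t ≤ δ^k; quasi-monotonicity bridges the gap
between s and δ^k t. The factor 2 comes from 2^(-k) = 2 (δ^(k+1))^θ. -/
lemma le_rpow_mul_of_geometric_decay {φ : ℝ → ℝ} {V B δ θ : ℝ} (hB : 0 ≤ B) (hδ : 0 < δ)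
    (hδ1 : δ < 1) (hθ : 0 ≤ θ) (hδθ : δ ^ θ = 1 / 2) (hφ0 : ∀ t, 0 < t → 0 ≤ φ t)
    (h1 : ∀ s t, 0 < s → s ≤ t → t ≤ V → φ s ≤ B * φ t)
    (h2 : ∀ t, 0 < t → t ≤ V → φ (δ * t) ≤ 1 / 2 * φ t)
    {s t : ℝ} (hs : 0 < s) (hst : s ≤ t) (htV : t ≤ V) :
    φ s ≤ 2 * B * (s / t) ^ θ * φ t := by
  have ht : 0 < t := hs.trans_le hst
  have hpow : ∀ k : ℕ, φ (δ ^ k * t) ≤ (1 / 2) ^ k * φ t := by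
    intro k
    induction k with
    | zero => simp
    | succ k ih =>
      have hk : δ ^ k * t ≤ V := (mul_le_of_le_one_left ht.le (pow_le_one₀ hδ.le hδ1.le)).trans htV
      rw [pow_succ', mul_assoc]
      refine (h2 _ (by positivity) hk).trans ?_
      rw [pow_succ', mul_assoc]
      gcongr
  obtain ⟨k, hk1, hk2⟩ := exists_nat_pow_near_of_lt_one (div_pos hs ht) ((div_le_one ht).2 hst)
    hδ hδ1
  rw [lt_div_iff₀ ht] at hk1
  rw [div_le_iff₀ ht] at hk2
  have hk : δ ^ k * t ≤ V := (mul_le_of_le_one_left ht.le (pow_le_one₀ hδ.le hδ1.le)).trans htV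
  have hφt := hφ0 t ht
  calc φ s ≤ B * φ (δ ^ k * t) := h1 s _ hs hk2 hk
    _ ≤ B * ((1 / 2) ^ k * φ t) := by
      have := hpow k
      gcongr
    _ = 2 * B * (δ ^ (k + 1)) ^ θ * φ t := by
      rw [← Real.rpow_natCast δ, ← Real.rpow_mul hδ.le, mul_comm ((k + 1 : ℕ) : ℝ) θ,
        Real.rpow_mul hδ.le, Real.rpow_natCast, hδθ, pow_succ]
      ring
    _ ≤ 2 * B * (s / t) ^ θ * φ t := by
      have : δ ^ (k + 1) ≤ s / t := by
        rw [le_div_iff₀ ht]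
        exact hk1.le
      gcongr

lemma lintegral_rpow_div_le_of_decay {φ : ℝ → ℝ} {A θ r t : ℝ} (hA : 0 ≤ A) (hθ : 0 < θ)
    (hr : 0 < r) (ht : 0 < t) (hφ0 : ∀ s, 0 < s → 0 ≤ φ s)
    (h : ∀ s, 0 < s → s < t → φ s ≤ A * (s / t) ^ θ * φ t) :
    ∫⁻ s in Ioo 0 t, ENNReal.ofReal (φ s ^ r / s) ≤
      ENNReal.ofReal (A ^ r / (θ * r) * φ t ^ r) := by
  have hφt := hφ0 t ht
  have hθr : 0 < θ * r := by positivity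
  calc ∫⁻ s in Ioo 0 t, ENNReal.ofReal (φ s ^ r / s)
      ≤ ∫⁻ s in Ioo 0 t, ENNReal.ofReal (A ^ r * φ t ^ r / t ^ (θ * r)) *
          ENNReal.ofReal (s ^ (θ * r - 1)) := by
        refine setLIntegral_mono' measurableSet_Ioo fun s hs => ?_
        have hs0 := hs.1
        have hφs := hφ0 s hs0
        rw [← ENNReal.ofReal_mul (by positivity)]
        refine ENNReal.ofReal_le_ofReal ?_
        calc φ s ^ r / s ≤ (A * (s / t) ^ θ * φ t) ^ r / s := by
              have := h s hs0 hs.2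
              gcongr
          _ = _ := by
              rw [Real.mul_rpow (by positivity) hφt, Real.mul_rpow hA (by positivity),
                ← Real.rpow_mul (by positivity), Real.div_rpow hs0.le ht.le,
                Real.rpow_sub_one hs0.ne']
              ring
    _ = ENNReal.ofReal (A ^ r / (θ * r) * φ t ^ r) := by
        rw [lintegral_const_mul' _ _ ENNReal.ofReal_ne_top, lintegral_Ioo_rpow hθr ht,
          ← ENNReal.ofReal_mul (by positivity)]
        congr 1
        have : 0 < t ^ (θ * r) := by positivity
        field_simp

/-- **Self-improvement.** An integral bound for `s^(1/p) f*(s)`, uniform over the truncations of `w`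
to cubes, implies a bound for every power of `s^(1/p) f**(s)` at every scale. -/
theorem exists_lintegral_scaledPrimitive_le {w : (Fin n → ℝ) → ℝ}
    (hw : LocallyIntegrable w volume) {p r : ℝ} (hp : 1 < p) (hr : 0 < r)
    (h : ∃ C, 0 < C ∧ ∀ (c : Fin n → ℝ) (R : ℝ), 0 < R →
      ∫⁻ u in Ioo 0 ((2 * R) ^ n),
        ENNReal.ofReal ((rearr (cut w c R) u * u ^ (1 / p)) ^ r / u) ≤
      ENNReal.ofReal (C * scaledPrimitive p (cut w c R) ((2 * R) ^ n) ^ r))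
    {q : ℝ} (hq : 0 < q) :
    ∃ C, 0 < C ∧ ∀ (c : Fin n → ℝ) (R : ℝ), 0 < R → ∀ t, 0 < t → t ≤ (2 * R) ^ n →
      ∫⁻ s in Ioo 0 t, ENNReal.ofReal (scaledPrimitive p (cut w c R) s ^ q / s) ≤
        ENNReal.ofReal (C * scaledPrimitive p (cut w c R) t ^ q) := by
  obtain ⟨C, hC, h⟩ := h
  have hp0 : 0 < p := by linarith
  have hp' := one_sub_inv_pos hp
  have hφ0 : ∀ c R t, 0 < t → 0 ≤ scaledPrimitive p (cut w c R) t := fun c R t ht =>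
    scaledPrimitive_nonneg p _ ht.le
  set N : ℝ := (5 ^ n) ^ (1 / p) with hN
  have hN1 : 1 ≤ N := Real.one_le_rpow (one_le_pow₀ (by norm_num)) (by positivity)
  obtain ⟨B₀, hB₀1, hweak⟩ : ∃ B₀, 1 ≤ B₀ ∧ ∀ (c : Fin n → ℝ) (R : ℝ), 0 < R →
      ∀ s, 0 < s → s < 1 * (2 * R) ^ n → rearr (cut w c R) s * s ^ (1 / p) ≤
        B₀ * scaledPrimitive p (cut w c R) ((2 * R) ^ n) := by
    refine ⟨max 1 (2 ^ (1 / p) * (2 * C) ^ (1 / r)), le_max_left _ _, fun c R hR s hs hsV => ?_⟩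
    have hφV := hφ0 c R ((2 * R) ^ n) (by positivity)
    refine (rearr_mul_rpow_le_of_lintegral_le (integrable_cut hw c R) hp hr hC.le hφV
      (h c R hR) hs (by linarith)).trans ?_
    gcongr
    exact le_max_right _ _
  -- First localisation, with δ = δ' = 1, followed by integration of the weak bound.
  obtain ⟨B, hB1, hquasi⟩ : ∃ B, 1 ≤ B ∧ ∀ (c : Fin n → ℝ) (R : ℝ), 0 < R →
      ∀ s t, 0 < s → s ≤ t → t ≤ (2 * R) ^ n →
        scaledPrimitive p (cut w c R) s ≤ B * scaledPrimitive p (cut w c R) t := by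
    refine ⟨N * B₀ / (1 - 1 / p), ?_, fun c R hR s t hs hst htV => ?_⟩
    · rw [le_div_iff₀ hp']
      have : 0 < 1 / p := by positivity
      nlinarith
    · have ht := hs.trans_le hst
      have hφt := hφ0 c R t ht
      rw [div_mul_eq_mul_div]
      refine scaledPrimitive_le_of_rearr_le (integrable_cut hw c R) hp (by positivity) hs
        fun u hu hus => ?_
      exact rearr_le_scaledPrimitive_of_forall_cube hw hp (by linarith) one_pos le_rfl hweak
        zero_le_one le_rfl (by rw [Real.one_rpow]; nlinarith) c hR ht htV hu (by linarith)
  have hB0 : 0 < B := by linarith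
  obtain ⟨κ, hκ, hκ1, hBκ⟩ : ∃ κ, 0 < κ ∧ κ ≤ 1 ∧ B * κ ^ (1 - 1 / p) ≤ 1 / 2 := by
    refine ⟨(1 / (2 * B)) ^ (1 - 1 / p)⁻¹, by positivity, ?_, ?_⟩
    · refine Real.rpow_le_one (by positivity) ?_ (by positivity)
      rw [div_le_one (by positivity)]
      linarith
    · rw [← Real.rpow_mul (by positivity), inv_mul_cancel₀ hp'.ne', Real.rpow_one]
      apply le_of_eq
      field_simp
  -- Localisation costs N and integration costs 1/(1 - 1/p); ε is the weak constant for which the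
  -- product is exactly 1/2.
  obtain ⟨ε, hε, hεN⟩ : ∃ ε, 0 < ε ∧ N * ε / (1 - 1 / p) = 1 / 2 :=
    ⟨(1 - 1 / p) / (2 * N), by positivity, by
      generalize 1 - 1 / p = a at hp' ⊢
      field_simp⟩
  obtain ⟨δ₀, hδ₀, hδ₀1, hsmall⟩ : ∃ δ₀, 0 < δ₀ ∧ δ₀ ≤ 1 ∧ ∀ (c : Fin n → ℝ) (R : ℝ), 0 < R →
      ∀ s, 0 < s → s < δ₀ * (2 * R) ^ n → rearr (cut w c R) s * s ^ (1 / p) ≤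
        ε * scaledPrimitive p (cut w c R) ((2 * R) ^ n) := by
    -- Below V exp(-L) the logarithm is at least L, which is exactly enough to force φ(s) ≤ ε φ(V).
    set L := (B * (2 / κ ^ (1 / p))) ^ r * C / ε ^ r with hL
    have hL0 : 0 < L := by positivity
    refine ⟨Real.exp (-L), Real.exp_pos _, Real.exp_le_one_iff.2 (by linarith),
      fun c R hR s hs hsV => ?_⟩
    have hV : 0 < (2 * R) ^ n := by positivity
    have hφV := hφ0 c R _ hV
    have hφs := hφ0 c R s hs
    refine (rearr_mul_rpow_le_scaledPrimitive (integrable_cut hw c R) p hs).trans ?_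
    have hsV' : s ≤ (2 * R) ^ n := hsV.le.trans
      (mul_le_of_le_one_left hV.le (Real.exp_le_one_iff.2 (by linarith)))
    have h1 := rpow_mul_log_le (integrable_cut hw c R) hr hB0 hκ hκ1 hBκ (by positivity)
      (h c R hR) (hquasi c R hR) hs hsV'
    have h2 : L ≤ Real.log ((2 * R) ^ n / s) := by
      rw [Real.le_log_iff_exp_le (by positivity), le_div_iff₀ hs]
      rw [Real.exp_neg, inv_mul_eq_div, lt_div_iff₀ (Real.exp_pos _)] at hsV
      linarith
    have h3 : scaledPrimitive p (cut w c R) s ^ r * L ≤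
        L * (ε * scaledPrimitive p (cut w c R) ((2 * R) ^ n)) ^ r := by
      calc scaledPrimitive p (cut w c R) s ^ r * L
          ≤ scaledPrimitive p (cut w c R) s ^ r * Real.log ((2 * R) ^ n / s) := by gcongr
        _ ≤ _ := h1
        _ = _ := by
          rw [Real.mul_rpow hε.le hφV, hL]
          have : 0 < ε ^ r := by positivity
          field_simp
    rw [mul_comm] at h3
    exact (Real.rpow_le_rpow_iff hφs (by positivity) hr).1 (le_of_mul_le_mul_left h3 hL0)
  obtain ⟨δ, hδ, hδ1, hdecay⟩ : ∃ δ, 0 < δ ∧ δ < 1 ∧ ∀ (c : Fin n → ℝ) (R : ℝ), 0 < R →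
      ∀ t, 0 < t → t ≤ (2 * R) ^ n → scaledPrimitive p (cut w c R) (δ * t) ≤
        1 / 2 * scaledPrimitive p (cut w c R) t := by
    have hx : 0 < N * ε * δ₀ := by positivity
    -- Second localisation, now with constant ε: the power p is what the hypothesis on δ' requires.
    -- Halving δ' afterwards keeps the ratio strictly below 1.
    set δ' := min 1 ((N * ε * δ₀) ^ p) with hδ'
    have hδ'0 : 0 < δ' := lt_min one_pos (by positivity)
    have hδ'1 : δ' ≤ 1 := min_le_left _ _
    refine ⟨δ' / 2, by positivity, by linarith, fun c R hR t ht htV => ?_⟩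
    have hφt := hφ0 c R t ht
    rw [← hεN, div_mul_eq_mul_div (N * ε)]
    refine scaledPrimitive_le_of_rearr_le (integrable_cut hw c R) hp (by positivity)
      (by positivity) fun u hu hut => ?_
    refine rearr_le_scaledPrimitive_of_forall_cube hw hp hε hδ₀ hδ₀1 hsmall hδ'0.le hδ'1 ?_ c hR
      ht htV hu (hut.trans (by nlinarith))
    calc δ' ^ (1 / p) ≤ ((N * ε * δ₀) ^ p) ^ (1 / p) := by
          gcongr
          exact min_le_right _ _
      _ = N * ε * δ₀ := by
          rw [← Real.rpow_mul hx.le, mul_one_div_cancel hp0.ne', Real.rpow_one]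
  have hθ : 0 < Real.logb δ (1 / 2) :=
    Real.logb_pos_of_base_lt_one hδ hδ1 (by norm_num) (by norm_num)
  refine ⟨(2 * B) ^ q / (Real.logb δ (1 / 2) * q), by positivity, fun c R hR t ht htV => ?_⟩
  refine lintegral_rpow_div_le_of_decay (by positivity) hθ hq ht (hφ0 c R) fun s hs hst => ?_
  exact le_rpow_mul_of_geometric_decay hB0.le hδ hδ1 hθ.le
    (Real.rpow_logb hδ hδ1.ne (by norm_num)) (hφ0 c R) (hquasi c R hR) (hdecay c R hR) hs hst.le htV

/-! ### The two classes in terms of the scaled primitive -/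

lemma isCube_iff {Q : Set (Fin n → ℝ)} : IsCube Q ↔ ∃ c R, 0 < R ∧ Q = closedBall c R := by
  have hIcc : ∀ (c : Fin n → ℝ) (R : ℝ), 0 < R →
      closedBall c R = Icc (fun i => c i - R) (fun i => c i + R) := fun c R hR => by
    rw [closedBall_pi c hR.le, ← pi_univ_Icc]
    simp only [Real.closedBall_eq_Icc]
  constructor
  · rintro ⟨a, h, hh, rfl⟩
    refine ⟨fun i => a i + h / 2, h / 2, by positivity, ?_⟩
    rw [hIcc _ _ (by positivity)]
    congr 1 <;> funext i <;> ring
  · rintro ⟨c, R, hR, rfl⟩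
    refine ⟨fun i => c i - R, 2 * R, by positivity, ?_⟩
    rw [hIcc c R hR]
    congr 1
    funext i
    ring

lemma forall_isCube_iff {P : Set (Fin n → ℝ) → Prop} :
    (∀ Q, IsCube Q → P Q) ↔ ∀ (c : Fin n → ℝ) (R : ℝ), 0 < R → P (closedBall c R) := by
  refine ⟨fun h c R hR => h _ (isCube_iff.2 ⟨c, R, hR, rfl⟩), fun h Q hQ => ?_⟩
  obtain ⟨c, R, hR, rfl⟩ := isCube_iff.1 hQ
  exact h c R hR

lemma avg_closedBall {w : (Fin n → ℝ) → ℝ} (hw : LocallyIntegrable w volume) (c : Fin n → ℝ)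
    {R : ℝ} (hR : 0 < R) :
    avg (closedBall c R) w =
      ENNReal.ofReal (primitive (cut w c R) ((2 * R) ^ n) / (2 * R) ^ n) := by
  rw [avg, ← ofReal_primitive_cut hw c hR, volume_closedBall_eq c hR,
    ENNReal.ofReal_div_of_pos (by positivity)]

lemma maxRearrangement_rpow_mul {f : (Fin n → ℝ) → ℝ} (hf : Integrable f) {p q t : ℝ}
    (hq : 0 < q) (ht : 0 < t) :
    maxRearrangement f t ^ q * ENNReal.ofReal t ^ (q / p) / ENNReal.ofReal t =
      ENNReal.ofReal (scaledPrimitive p f t ^ q / t) := by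
  have hF := primitive_nonneg f t
  rw [maxRearrangement, ← ofReal_primitive hf, ← ENNReal.ofReal_div_of_pos ht,
    ENNReal.ofReal_rpow_of_nonneg (by positivity) hq.le, ENNReal.ofReal_rpow_of_pos ht,
    ← ENNReal.ofReal_mul (by positivity), ← ENNReal.ofReal_div_of_pos ht, scaledPrimitive_eq p f ht,
    Real.mul_rpow (by positivity) (by positivity), ← Real.rpow_mul ht.le, one_div_mul_eq_div]

lemma lorentzNorm_eq {f : (Fin n → ℝ) → ℝ} (hf : Integrable f) {p q : ℝ} (hq : 0 < q) :
    lorentzNorm p q f =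
      (∫⁻ t in Ioi (0 : ℝ), ENNReal.ofReal (scaledPrimitive p f t ^ q / t)) ^ (1 / q) := by
  rw [lorentzNorm]
  congr 1
  exact setLIntegral_congr_fun measurableSet_Ioi fun t ht => maxRearrangement_rpow_mul hf hq ht

lemma rpow_one_div_le_ofReal_iff {I : ℝ≥0∞} {r x : ℝ} (hr : 0 < r) (hx : 0 ≤ x) :
    I ^ (1 / r) ≤ ENNReal.ofReal x ↔ I ≤ ENNReal.ofReal (x ^ r) := by
  rw [one_div, ENNReal.rpow_inv_le_iff hr, ENNReal.ofReal_rpow_of_nonneg hx hr.le]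

lemma exists_pos_rpow_iff {P : ℝ → Prop} {r : ℝ} (hr : 0 < r) :
    (∃ C, 0 < C ∧ P (C ^ r)) ↔ ∃ C, 0 < C ∧ P C := by
  constructor
  · rintro ⟨C, hC, h⟩
    exact ⟨C ^ r, by positivity, h⟩
  · rintro ⟨C, hC, h⟩
    refine ⟨C ^ r⁻¹, by positivity, ?_⟩
    rwa [Real.rpow_inv_rpow hC.le hr.ne']

/-- Multiplying by |Q|^(1/p) turns the average over the cube into φ(|Q|); the q-th power is absorbed
into the constant. -/
lemma mem_RHLorentz_iff {w : (Fin n → ℝ) → ℝ} (hw : IsWeight w) {p q : ℝ} (hq : 0 < q) :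
    w ∈ RHLorentz n p q ↔ ∃ C : ℝ, 0 < C ∧ ∀ (c : Fin n → ℝ) (R : ℝ), 0 < R →
      ∫⁻ t in Ioi (0 : ℝ), ENNReal.ofReal (scaledPrimitive p (cut w c R) t ^ q / t) ≤
        ENNReal.ofReal (C * scaledPrimitive p (cut w c R) ((2 * R) ^ n) ^ q) := by
  rw [← exists_pos_rpow_iff hq]
  simp only [RHLorentz, mem_ofPred_eq, hw, true_and, forall_isCube_iff]
  refine exists_congr fun C => and_congr_right fun hC => forall_congr' fun c =>
    forall_congr' fun R => forall_congr' fun hR => ?_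
  have hV : 0 < (2 * R) ^ n := by positivity
  have hF := primitive_nonneg (cut w c R) ((2 * R) ^ n)
  have hφ := scaledPrimitive_nonneg p (cut w c R) hV.le
  rw [← Real.mul_rpow hC.le hφ, ← rpow_one_div_le_ofReal_iff hq (by positivity),
    ← lorentzNorm_eq (integrable_cut hw.1 c R) hq, avg_closedBall hw.1 c hR,
    volume_closedBall_eq c hR, ENNReal.ofReal_rpow_of_pos hV,
    ENNReal.div_le_iff (by simpa using Real.rpow_pos_of_pos hV _) ENNReal.ofReal_ne_top,
    ← ENNReal.ofReal_mul hC.le, ← ENNReal.ofReal_mul (by positivity), scaledPrimitive_eq p _ hV,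
    mul_assoc]
  rfl

lemma mem_RH_iff {w : (Fin n → ℝ) → ℝ} (hw : IsWeight w) {p : ℝ} (hp : 0 < p) :
    w ∈ RH n p ↔ ∃ C : ℝ, 0 < C ∧ ∀ (c : Fin n → ℝ) (R : ℝ), 0 < R →
      ∫⁻ x in closedBall c R, ‖w x‖ₑ ^ p ≤
        ENNReal.ofReal (C * scaledPrimitive p (cut w c R) ((2 * R) ^ n) ^ p) := by
  rw [← exists_pos_rpow_iff hp]
  simp only [RH, mem_ofPred_eq, hw, true_and, forall_isCube_iff]
  refine exists_congr fun C => and_congr_right fun hC => forall_congr' fun c =>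
    forall_congr' fun R => forall_congr' fun hR => ?_
  have hV : 0 < (2 * R) ^ n := by positivity
  have hF := primitive_nonneg (cut w c R) ((2 * R) ^ n)
  rw [avg_closedBall hw.1 c hR, volume_closedBall_eq c hR, ← ENNReal.ofReal_mul hC.le,
    rpow_one_div_le_ofReal_iff hp (by positivity),
    ENNReal.div_le_iff (by simpa using hV) ENNReal.ofReal_ne_top,
    ← ENNReal.ofReal_mul (by positivity), scaledPrimitive_eq p _ hV,
    Real.mul_rpow hC.le (by positivity), Real.mul_rpow (by positivity) (by positivity),
    ← Real.rpow_mul hV.le, one_div_mul_cancel hp.ne', Real.rpow_one, mul_assoc]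

/-! ### The K-functional -/

/-- A bounded summand raises the rearrangement by at most its sup norm: f* ≤ f₀* + ‖f₁‖_∞.
Integration over (0, t) gives the bound for every decomposition. -/
lemma primitive_le_kFunctional {f : (Fin n → ℝ) → ℝ} (hf : Integrable f) {Q : Set (Fin n → ℝ)}
    (hQ : MeasurableSet Q) (hfQ : ∀ x ∉ Q, f x = 0) (t : ℝ) :
    ENNReal.ofReal (primitive f t) ≤ kFunctional Q t f := by
  refine le_iInf fun f₀ => le_iInf fun f₁ => le_iInf fun h₀ => le_iInf fun h₁ => le_iInf fun h => ?_
  have hint : Integrable (Q.indicator f₀) :=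
    (integrable_indicator_iff hQ).2 (memLp_one_iff_integrable.1 h₀)
  set b := eLpNorm f₁ ∞ (volume.restrict Q) with hb
  have hb1 : ∀ᵐ x ∂(volume.restrict Q), ‖f₁ x‖ₑ ≤ b := by
    rw [hb, eLpNorm_exponent_top]
    exact ae_le_eLpNormEssSup
  rw [ae_restrict_iff' hQ] at h hb1
  have hle : ∀ s, rearrangement f s ≤ rearrangement (Q.indicator f₀) s + b := by
    intro s
    rw [rearrangement_le_iff]
    refine le_trans (measure_mono_ae ?_)
      ((rearrangement_le_iff (Q.indicator f₀) s _).1 le_rfl)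
    filter_upwards [h, hb1] with x hx hbx
    intro (hlt : _ < ‖f x‖ₑ)
    change _ < ‖Q.indicator f₀ x‖ₑ
    by_cases hxQ : x ∈ Q
    · rw [indicator_of_mem hxQ]
      rw [hx hxQ] at hlt
      have h2 := hlt.trans_le ((enorm_add_le _ _).trans (add_le_add le_rfl (hbx hxQ)))
      exact lt_of_add_lt_add_right h2
    · rw [hfQ x hxQ, enorm_zero] at hlt
      exact absurd hlt not_lt_zero
  rw [ofReal_primitive hf]
  calc ∫⁻ s in Ioo 0 t, rearrangement f s
      ≤ ∫⁻ s in Ioo 0 t, (rearrangement (Q.indicator f₀) s + b) := lintegral_mono fun s => hle s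
    _ = (∫⁻ s in Ioo 0 t, rearrangement (Q.indicator f₀) s) + b * ENNReal.ofReal t := by
        rw [lintegral_add_right _ measurable_const, setLIntegral_const, Real.volume_Ioo, sub_zero]
    _ ≤ (∫⁻ x, ‖Q.indicator f₀ x‖ₑ) + b * ENNReal.ofReal t :=
        add_le_add (lintegral_Ioo_rearrangement_le hint t) le_rfl
    _ = eLpNorm f₀ 1 (volume.restrict Q) + ENNReal.ofReal t * b := by
        rw [eLpNorm_one_eq_lintegral_enorm, ← lintegral_indicator hQ, mul_comm]
        simp only [enorm_indicator_eq_indicator_enorm]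

/-- Split f along the level set {|f| > f*(t)}, of measure at most t: the large part has L¹ norm at
most F(t) by Hardy–Littlewood, and the small part costs at most t f*(t) ≤ F(t). -/
lemma kFunctional_le_primitive {f : (Fin n → ℝ) → ℝ} (hf : Integrable f) (Q : Set (Fin n → ℝ))
    {t : ℝ} (ht : 0 < t) :
    kFunctional Q t f ≤ ENNReal.ofReal (2 * primitive f t) := by
  set a := rearrangement f t with ha
  have hatop : a ≠ ⊤ := rearrangement_ne_top hf ht
  set A : Set (Fin n → ℝ) := {x | a < ‖f x‖ₑ} with hA
  have hAm : NullMeasurableSet A :=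
    nullMeasurableSet_lt aemeasurable_const hf.aestronglyMeasurable.enorm
  have hAt : volume A ≤ ENNReal.ofReal t := (rearrangement_le_iff f t a).1 le_rfl
  have hbound : ∀ x, ‖Aᶜ.indicator f x‖ₑ ≤ a := by
    intro x
    by_cases hx : x ∈ A
    · simp [hx]
    · rw [indicator_of_mem (show x ∈ Aᶜ from hx)]
      exact not_lt.1 hx
  have h₀ : MemLp (A.indicator f) 1 (volume.restrict Q) :=
    memLp_one_iff_integrable.2 (hf.indicator₀ hAm).restrict
  have h₁ : MemLp (Aᶜ.indicator f) ∞ (volume.restrict Q) := by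
    refine memLp_top_of_bound (hf.indicator₀ hAm.compl).aestronglyMeasurable.restrict a.toReal
      (Eventually.of_forall fun x => ?_)
    rw [← toReal_enorm]
    exact ENNReal.toReal_mono hatop (hbound x)
  refine iInf_le_of_le _ (iInf_le_of_le _ (iInf_le_of_le h₀ (iInf_le_of_le h₁ (iInf_le_of_le
    (Eventually.of_forall fun x => (congrFun (indicator_self_add_compl A f) x).symm) ?_))))
  rw [two_mul, ENNReal.ofReal_add (primitive_nonneg f t) (primitive_nonneg f t)]
  refine add_le_add ?_ ?_
  · rw [eLpNorm_one_eq_lintegral_enorm, ofReal_primitive hf]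
    refine (setLIntegral_le_lintegral _ _).trans ?_
    simp only [enorm_indicator_eq_indicator_enorm]
    rw [lintegral_indicator₀ hAm]
    exact setLIntegral_le_lintegral_rearrangement hf hAm hAt
  · calc ENNReal.ofReal t * eLpNorm (Aᶜ.indicator f) ∞ (volume.restrict Q)
        ≤ ENNReal.ofReal t * a := by
          gcongr
          rw [eLpNorm_exponent_top]
          exact eLpNormEssSup_le_of_ae_enorm_bound (Eventually.of_forall hbound)
      _ = ENNReal.ofReal (t * rearr f t) := by rw [ENNReal.ofReal_mul ht.le, ofReal_rearr hf ht]
      _ ≤ _ := ENNReal.ofReal_le_ofReal (mul_rearr_le_primitive hf ht)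

lemma ofReal_scaledPrimitive (p : ℝ) (f : (Fin n → ℝ) → ℝ) {t : ℝ} (ht : 0 < t) :
    ENNReal.ofReal (primitive f t) * ENNReal.ofReal t ^ (1 / p - 1) =
      ENNReal.ofReal (scaledPrimitive p f t) := by
  rw [scaledPrimitive, ENNReal.ofReal_mul (primitive_nonneg f t), ENNReal.ofReal_rpow_of_pos ht]

lemma phi_closedBall {p : ℝ} (hp : 1 < p) (w : (Fin n → ℝ) → ℝ) (c : Fin n → ℝ) (R s : ℝ) :
    phi p w (closedBall c R) s =
      kFunctional (closedBall c R) s (cut w c R) * ENNReal.ofReal s ^ (1 / p - 1) := by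
  have : -(1 / p.conjExponent) = 1 / p - 1 := by
    rw [Real.conjExponent]
    field_simp
    ring
  rw [phi, this, cut]

lemma scaledPrimitive_le_phi {w : (Fin n → ℝ) → ℝ} (hw : LocallyIntegrable w volume) {p : ℝ}
    (hp : 1 < p) (c : Fin n → ℝ) (R : ℝ) {s : ℝ} (hs : 0 < s) :
    ENNReal.ofReal (scaledPrimitive p (cut w c R) s) ≤ phi p w (closedBall c R) s := by
  rw [phi_closedBall hp, ← ofReal_scaledPrimitive p _ hs]
  gcongr
  exact primitive_le_kFunctional (integrable_cut hw c R) isClosed_closedBall.measurableSet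
    (fun x hx => indicator_of_notMem hx w) s

lemma phi_le_scaledPrimitive {w : (Fin n → ℝ) → ℝ} (hw : LocallyIntegrable w volume) {p : ℝ}
    (hp : 1 < p) (c : Fin n → ℝ) (R : ℝ) {s : ℝ} (hs : 0 < s) :
    phi p w (closedBall c R) s ≤ ENNReal.ofReal (2 * scaledPrimitive p (cut w c R) s) := by
  rw [phi_closedBall hp, ENNReal.ofReal_mul zero_le_two, ← ofReal_scaledPrimitive p _ hs, ← mul_assoc,
    ← ENNReal.ofReal_mul zero_le_two]
  gcongr
  exact kFunctional_le_primitive (integrable_cut hw c R) _ hs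

/-- The `K`-functional condition is a condition on `s^(1/p) f**(s)`. -/
lemma kFunctional_condition_iff {w : (Fin n → ℝ) → ℝ} (hw : LocallyIntegrable w volume) {p q : ℝ}
    (hp : 1 < p) (hq : 0 < q) :
    (∃ C : ℝ, 0 < C ∧ ∀ Q : Set (Fin n → ℝ), IsCube Q →
      ∀ t : ℝ, 0 < t → ENNReal.ofReal t < volume Q →
        ∫⁻ s in Ioo (0 : ℝ) t, phi p w Q s ^ q / ENNReal.ofReal s ≤
          ENNReal.ofReal C * phi p w Q t ^ q) ↔
    ∃ C : ℝ, 0 < C ∧ ∀ (c : Fin n → ℝ) (R : ℝ), 0 < R → ∀ t, 0 < t → t < (2 * R) ^ n →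
      ∫⁻ s in Ioo 0 t, ENNReal.ofReal (scaledPrimitive p (cut w c R) s ^ q / s) ≤
        ENNReal.ofReal (C * scaledPrimitive p (cut w c R) t ^ q) := by
  have hφ0 : ∀ c R t, 0 < t → 0 ≤ scaledPrimitive p (cut w c R) t := fun c R t ht =>
    scaledPrimitive_nonneg p _ ht.le
  simp only [forall_isCube_iff]
  constructor
  · rintro ⟨C, hC, h⟩
    refine ⟨C * 2 ^ q, by positivity, fun c R hR t ht htV => ?_⟩
    have hφt := hφ0 c R t ht
    calc ∫⁻ s in Ioo 0 t, ENNReal.ofReal (scaledPrimitive p (cut w c R) s ^ q / s)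
        ≤ ∫⁻ s in Ioo 0 t, phi p w (closedBall c R) s ^ q / ENNReal.ofReal s := by
          refine setLIntegral_mono' measurableSet_Ioo fun s hs => ?_
          rw [ENNReal.ofReal_div_of_pos hs.1,
            ← ENNReal.ofReal_rpow_of_nonneg (hφ0 c R s hs.1) hq.le]
          gcongr
          exact scaledPrimitive_le_phi hw hp c R hs.1
      _ ≤ ENNReal.ofReal C * phi p w (closedBall c R) t ^ q := by
          refine h c R hR t ht ?_
          rwa [volume_closedBall_eq c hR, ENNReal.ofReal_lt_ofReal_iff_of_nonneg ht.le]
      _ ≤ ENNReal.ofReal C * ENNReal.ofReal (2 * scaledPrimitive p (cut w c R) t) ^ q := by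
          gcongr
          exact phi_le_scaledPrimitive hw hp c R ht
      _ = _ := by
          rw [ENNReal.ofReal_rpow_of_nonneg (by positivity) hq.le, ← ENNReal.ofReal_mul hC.le,
            Real.mul_rpow zero_le_two hφt, mul_assoc]
  · rintro ⟨C, hC, h⟩
    refine ⟨2 ^ q * C, by positivity, fun c R hR t ht htV => ?_⟩
    rw [volume_closedBall_eq c hR, ENNReal.ofReal_lt_ofReal_iff_of_nonneg ht.le] at htV
    have hφt := hφ0 c R t ht
    calc ∫⁻ s in Ioo 0 t, phi p w (closedBall c R) s ^ q / ENNReal.ofReal s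
        ≤ ∫⁻ s in Ioo 0 t, ENNReal.ofReal (2 ^ q) *
            ENNReal.ofReal (scaledPrimitive p (cut w c R) s ^ q / s) := by
          refine setLIntegral_mono' measurableSet_Ioo fun s hs => ?_
          have hφs := hφ0 c R s hs.1
          rw [← ENNReal.ofReal_mul (by positivity), ← mul_div_assoc,
            ← Real.mul_rpow zero_le_two hφs, ENNReal.ofReal_div_of_pos hs.1,
            ← ENNReal.ofReal_rpow_of_nonneg (by positivity) hq.le]
          gcongr
          exact phi_le_scaledPrimitive hw hp c R hs.1
      _ ≤ ENNReal.ofReal (2 ^ q) *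
            ENNReal.ofReal (C * scaledPrimitive p (cut w c R) t ^ q) := by
          rw [lintegral_const_mul' _ _ ENNReal.ofReal_ne_top]
          gcongr
          exact h c R hR t ht htV
      _ = ENNReal.ofReal (2 ^ q * C) * ENNReal.ofReal (scaledPrimitive p (cut w c R) t) ^ q := by
          rw [ENNReal.ofReal_rpow_of_nonneg hφt hq.le, ← ENNReal.ofReal_mul (by positivity),
            ← ENNReal.ofReal_mul (by positivity), mul_assoc]
      _ ≤ _ := by
          gcongr
          exact scaledPrimitive_le_phi hw hp c R ht

/-! ### Passage between the condition at all scales and the classes -/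

/-- Away from the origin the Lorentz integral is controlled by `∫_Q |w|`. -/
lemma lintegral_Ioi_scaledPrimitive_le {w : (Fin n → ℝ) → ℝ} (hw : LocallyIntegrable w volume)
    {p q C : ℝ} (hp : 1 < p) (hq : 0 < q) (hC : 0 < C) (c : Fin n → ℝ) {R : ℝ} (hR : 0 < R)
    (h : ∫⁻ s in Ioo 0 ((2 * R) ^ n / 2),
        ENNReal.ofReal (scaledPrimitive p (cut w c R) s ^ q / s) ≤
      ENNReal.ofReal (C * scaledPrimitive p (cut w c R) ((2 * R) ^ n / 2) ^ q)) :
    ∫⁻ s in Ioi (0 : ℝ), ENNReal.ofReal (scaledPrimitive p (cut w c R) s ^ q / s) ≤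
      ENNReal.ofReal ((C + 1 / ((1 - 1 / p) * q)) * (2 ^ (1 - 1 / p)) ^ q *
        scaledPrimitive p (cut w c R) ((2 * R) ^ n) ^ q) := by
  have hp' := one_sub_inv_pos hp
  have ha : 0 < (1 - 1 / p) * q := by positivity
  have hV : 0 < (2 * R) ^ n := by positivity
  have hV2 : 0 < (2 * R) ^ n / 2 := by positivity
  have hle := primitive_cut_le hw c hR
  have hexp : 1 / p - 1 = -(1 - 1 / p) := by ring
  set V := (2 * R) ^ n
  set f := cut w c R
  have hF := primitive_nonneg f V
  have hφV := scaledPrimitive_nonneg p f hV.le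
  -- The cut is made at V/2 because the condition concerns only t < |Q|. Beyond it F ≤ F(V), so φ(s)
  -- ≤ F(V) s^(1/p - 1), whose q-th power is integrable at infinity against ds/s.
  have hhalf : primitive f V * (V / 2) ^ (1 / p - 1) =
      2 ^ (1 - 1 / p) * scaledPrimitive p f V := by
    rw [scaledPrimitive, Real.div_rpow hV.le zero_le_two, hexp, Real.rpow_neg zero_le_two]
    field_simp
  have htail : ∫⁻ s in Ici (V / 2), ENNReal.ofReal (scaledPrimitive p f s ^ q / s) ≤
      ENNReal.ofReal (1 / ((1 - 1 / p) * q) * ((2 ^ (1 - 1 / p)) ^ q *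
        scaledPrimitive p f V ^ q)) := by
    rw [setLIntegral_congr Ioi_ae_eq_Ici.symm]
    calc ∫⁻ s in Ioi (V / 2), ENNReal.ofReal (scaledPrimitive p f s ^ q / s)
        ≤ ∫⁻ s in Ioi (V / 2), ENNReal.ofReal (primitive f V ^ q) *
            ENNReal.ofReal (s ^ (-((1 - 1 / p) * q) - 1)) := by
          refine setLIntegral_mono' measurableSet_Ioi fun s hs => ?_
          have hs0 : 0 < s := hV2.trans hs
          rw [← ENNReal.ofReal_mul (by positivity)]
          refine ENNReal.ofReal_le_ofReal ?_
          rw [Real.rpow_sub_one hs0.ne', ← neg_mul, ← hexp, Real.rpow_mul hs0.le, ← mul_div_assoc,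
            ← Real.mul_rpow hF (by positivity), scaledPrimitive]
          have := hle s
          have := primitive_nonneg f s
          gcongr
      _ = _ := by
          rw [lintegral_const_mul' _ _ ENNReal.ofReal_ne_top, lintegral_Ioi_rpow ha hV2,
            ← ENNReal.ofReal_mul (by positivity), ← Real.mul_rpow (by positivity) hφV, ← hhalf,
            Real.mul_rpow hF (by positivity), ← neg_mul, ← hexp, Real.rpow_mul hV2.le]
          congr 1
          ring
  have hhead : scaledPrimitive p f (V / 2) ^ q ≤
      (2 ^ (1 - 1 / p)) ^ q * scaledPrimitive p f V ^ q := by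
    rw [← Real.mul_rpow (by positivity) hφV, ← hhalf]
    have h1 := scaledPrimitive_nonneg p f hV2.le
    refine Real.rpow_le_rpow h1 ?_ hq.le
    rw [scaledPrimitive]
    have := hle (V / 2)
    gcongr
  calc ∫⁻ s in Ioi (0 : ℝ), ENNReal.ofReal (scaledPrimitive p f s ^ q / s)
      ≤ (∫⁻ s in Ioo 0 (V / 2), ENNReal.ofReal (scaledPrimitive p f s ^ q / s)) +
          ∫⁻ s in Ici (V / 2), ENNReal.ofReal (scaledPrimitive p f s ^ q / s) := by
        refine le_trans (lintegral_mono_set fun s hs => ?_) (lintegral_union_le _ _ _)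
        exact (lt_or_ge s (V / 2)).imp (fun h => ⟨hs, h⟩) id
    _ ≤ ENNReal.ofReal (C * ((2 ^ (1 - 1 / p)) ^ q * scaledPrimitive p f V ^ q)) +
          ENNReal.ofReal (1 / ((1 - 1 / p) * q) * ((2 ^ (1 - 1 / p)) ^ q *
            scaledPrimitive p f V ^ q)) := by
        refine add_le_add (h.trans (ENNReal.ofReal_le_ofReal ?_)) htail
        gcongr
    _ = _ := by
        rw [← ENNReal.ofReal_add (by positivity) (by positivity)]
        congr 1
        ring

lemma mem_RHLorentz_of_condition {w : (Fin n → ℝ) → ℝ} (hw : IsWeight w) {p q : ℝ} (hp : 1 < p)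
    (hq : 0 < q)
    (h : ∃ C : ℝ, 0 < C ∧ ∀ (c : Fin n → ℝ) (R : ℝ), 0 < R → ∀ t, 0 < t → t < (2 * R) ^ n →
      ∫⁻ s in Ioo 0 t, ENNReal.ofReal (scaledPrimitive p (cut w c R) s ^ q / s) ≤
        ENNReal.ofReal (C * scaledPrimitive p (cut w c R) t ^ q)) :
    w ∈ RHLorentz n p q := by
  obtain ⟨C, hC, h⟩ := h
  have hp' := one_sub_inv_pos hp
  refine (mem_RHLorentz_iff hw hq).2 ⟨(C + 1 / ((1 - 1 / p) * q)) * (2 ^ (1 - 1 / p)) ^ q,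
    by positivity, fun c R hR => ?_⟩
  have hV : 0 < (2 * R) ^ n := by positivity
  exact lintegral_Ioi_scaledPrimitive_le hw.1 hp hq hC c hR
    (h c R hR _ (by positivity) (half_lt_self hV))

/-- f*(s)^p = (s^(1/p) f*(s))^p / s ≤ φ(s)^p / s, and f* vanishes beyond |Q|, so the bound at t =
|Q| controls ∫_Q w^p. -/
lemma mem_RH_of_condition {w : (Fin n → ℝ) → ℝ} (hw : IsWeight w) {p : ℝ} (hp : 1 < p)
    (h : ∃ C : ℝ, 0 < C ∧ ∀ (c : Fin n → ℝ) (R : ℝ), 0 < R → ∀ t, 0 < t → t ≤ (2 * R) ^ n →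
      ∫⁻ s in Ioo 0 t, ENNReal.ofReal (scaledPrimitive p (cut w c R) s ^ p / s) ≤
        ENNReal.ofReal (C * scaledPrimitive p (cut w c R) t ^ p)) :
    w ∈ RH n p := by
  obtain ⟨C, hC, h⟩ := h
  have hp0 : 0 < p := by linarith
  refine (mem_RH_iff hw hp0).2 ⟨C, hC, fun c R hR => ?_⟩
  have hV : 0 < (2 * R) ^ n := by positivity
  have hf := integrable_cut hw.1 c R
  refine le_trans ?_ (h c R hR _ hV le_rfl)
  have hsupp : volume (Function.support (cut w c R)) ≤ volume (closedBall c R) :=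
    measure_mono support_indicator_subset
  rw [volume_closedBall_eq c hR] at hsupp
  rw [← lintegral_cut_rpow w c R hp0, ← lintegral_rearrangement_rpow hf hp0,
    ← inter_eq_left.2 (Ioo_subset_Ioi_self (a := (2 * R) ^ n) (b := (0 : ℝ))),
    ← setLIntegral_indicator measurableSet_Ioo]
  refine setLIntegral_mono' measurableSet_Ioi fun s (hs : 0 < s) => ?_
  by_cases hsV : s < (2 * R) ^ n
  · rw [indicator_of_mem (show s ∈ Ioo 0 ((2 * R) ^ n) from ⟨hs, hsV⟩), ← ofReal_rearr hf hs,
      ENNReal.ofReal_rpow_of_nonneg (rearr_nonneg _ _) hp0.le]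
    refine ENNReal.ofReal_le_ofReal ?_
    have hg := rearr_nonneg (cut w c R) s
    rw [le_div_iff₀ hs]
    calc rearr (cut w c R) s ^ p * s = (rearr (cut w c R) s * s ^ (1 / p)) ^ p := by
          rw [Real.mul_rpow hg (by positivity), ← Real.rpow_mul hs.le,
            one_div_mul_cancel hp0.ne', Real.rpow_one]
      _ ≤ _ := by
          have := rearr_mul_rpow_le_scaledPrimitive hf p hs
          gcongr
  · rw [rearrangement_eq_zero (hsupp.trans (ENNReal.ofReal_le_ofReal (not_lt.1 hsV))),
      ENNReal.zero_rpow_of_pos hp0]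
    exact zero_le

lemma condition_of_mem_RHLorentz {w : (Fin n → ℝ) → ℝ} {p q : ℝ} (hp : 1 < p) (hq : 0 < q)
    (h : w ∈ RHLorentz n p q) {r : ℝ} (hr : 0 < r) :
    ∃ C, 0 < C ∧ ∀ (c : Fin n → ℝ) (R : ℝ), 0 < R → ∀ t, 0 < t → t ≤ (2 * R) ^ n →
      ∫⁻ s in Ioo 0 t, ENNReal.ofReal (scaledPrimitive p (cut w c R) s ^ r / s) ≤
        ENNReal.ofReal (C * scaledPrimitive p (cut w c R) t ^ r) := by
  have hw : IsWeight w := h.1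
  obtain ⟨C, hC, h⟩ := (mem_RHLorentz_iff hw hq).1 h
  refine exists_lintegral_scaledPrimitive_le hw.1 hp hq ⟨C, hC, fun c R hR => ?_⟩ hr
  refine le_trans (le_trans ?_ (lintegral_mono_set
    (Ioo_subset_Ioi_self (a := (2 * R) ^ n)))) (h c R hR)
  refine setLIntegral_mono' measurableSet_Ioo fun s hs => ENNReal.ofReal_le_ofReal ?_
  have hs0 := hs.1
  have hg := rearr_nonneg (cut w c R) s
  have := rearr_mul_rpow_le_scaledPrimitive (integrable_cut hw.1 c R) p hs0
  gcongr

/-- By equimeasurability, ∫ w^p over the cube is the self-improvement integral with exponent p. -/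
lemma condition_of_mem_RH {w : (Fin n → ℝ) → ℝ} {p : ℝ} (hp : 1 < p)
    (h : w ∈ RH n p) {r : ℝ} (hr : 0 < r) :
    ∃ C, 0 < C ∧ ∀ (c : Fin n → ℝ) (R : ℝ), 0 < R → ∀ t, 0 < t → t ≤ (2 * R) ^ n →
      ∫⁻ s in Ioo 0 t, ENNReal.ofReal (scaledPrimitive p (cut w c R) s ^ r / s) ≤
        ENNReal.ofReal (C * scaledPrimitive p (cut w c R) t ^ r) := by
  have hp0 : 0 < p := by linarith
  have hw : IsWeight w := h.1
  obtain ⟨C, hC, h⟩ := (mem_RH_iff hw hp0).1 h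
  refine exists_lintegral_scaledPrimitive_le hw.1 hp hp0 ⟨C, hC, fun c R hR => ?_⟩ hr
  refine le_trans ?_ (h c R hR)
  have hf := integrable_cut hw.1 c R
  rw [← lintegral_cut_rpow w c R hp0, ← lintegral_rearrangement_rpow hf hp0]
  refine le_trans ?_ (lintegral_mono_set (Ioo_subset_Ioi_self (a := (2 * R) ^ n)))
  refine setLIntegral_mono' measurableSet_Ioo fun s hs => ?_
  have hs0 := hs.1
  have hg := rearr_nonneg (cut w c R) s
  rw [← ofReal_rearr hf hs0, ENNReal.ofReal_rpow_of_nonneg hg hp0.le,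
    Real.mul_rpow hg (by positivity), ← Real.rpow_mul hs0.le, one_div_mul_cancel hp0.ne',
    Real.rpow_one, mul_div_cancel_right₀ _ hs0.ne']

end ReverseHolder

theorem mainTheorem7 (n : ℕ) (hn : 1 ≤ n) (p q : ℝ) (hp : 1 < p) (hpq : p ≤ q) :
    ReverseHolder.RHLorentz n p q = ReverseHolder.RH n p ∧
    ∀ w : (Fin n → ℝ) → ℝ, ReverseHolder.IsWeight w →
      (w ∈ ReverseHolder.RHLorentz n p q ↔
        ∃ C : ℝ, 0 < C ∧ ∀ Q : Set (Fin n → ℝ), ReverseHolder.IsCube Q →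
          ∀ t : ℝ, 0 < t → ENNReal.ofReal t < volume Q →
            ∫⁻ s in Ioo (0 : ℝ) t, ReverseHolder.phi p w Q s ^ q / ENNReal.ofReal s ≤
              ENNReal.ofReal C * ReverseHolder.phi p w Q t ^ q) := by
  have hp0 : 0 < p := by linarith
  have hq : 0 < q := hp0.trans_le hpq
  refine ⟨Set.ext fun w => ⟨fun h => ?_, fun h => ?_⟩, fun w hw => ?_⟩
  · exact ReverseHolder.mem_RH_of_condition h.1 hp
      (ReverseHolder.condition_of_mem_RHLorentz hp hq h hp0)
  · obtain ⟨C, hC, hcond⟩ := ReverseHolder.condition_of_mem_RH hp h hq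
    exact ReverseHolder.mem_RHLorentz_of_condition h.1 hp hq
      ⟨C, hC, fun c R hR t ht htV => hcond c R hR t ht htV.le⟩
  · rw [ReverseHolder.kFunctional_condition_iff hw.1 hp hq]
    refine ⟨fun h => ?_, ReverseHolder.mem_RHLorentz_of_condition hw hp hq⟩
    obtain ⟨C, hC, hcond⟩ := ReverseHolder.condition_of_mem_RHLorentz hp hq h hq
    exact ⟨C, hC, fun c R hR t ht htV => hcond c R hR t ht htV.le⟩
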